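/- Let $d_y,d_r\ge 0$ and $\underline d>0$. There is a constant $c>0$ depending only on $d_y,d_r,\underline d$ such that the following holds for all integers $1\le m\le T$. Let $\mathcal T=\{1,\dots,T\}$, let $Q\subseteq\mathbb R^m$ be compact and convex, let $C\subseteq\mathbb R^m$ be a closed convex cone, and let $\Psi=Q+C$. Let $Z^1,\dots,Z^T$ be compact sets, $Z^t\subseteq\mathbb R\times\mathbb R^{n_t}\times\mathbb R^m$, whose elements are written $(r,\mathbf x,\mathbf y)$, such that: 1. there are $(r^t,\mathbf x^t,\mathbf y^t)\in Z^t$, $t\in\mathcal T$, with $\sum_{t}\mathbf y^t\in T\Psi$; 2. for all $t\in\mathcal T$, $\|\mathbf y-\mathbf v\|_\infty\le d_y$ for all $(r,\mathbf x,\mathbf y)\in Z^t$ and $\mathbf v\in Q$; 3. for all $t\in\mathcal T$ there is $(\tilde r,\tilde{\mathbf x},\tilde{\mathbf y})\in\operatorname{conv}(Z^t)$ with $\tilde r\ge \max_{(r,\mathbf x,\mathbf y)\in Z^t} r-d_r$ and such that the closed Euclidean ball of radius $\underline d$ around $\tilde{\mathbf y}$ is contained in $\Psi$. Put $$z^R=\max\Big\{\sum_{t=1}^T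 r^t:\ (r^t,\mathbf x^t,\mathbf y^t)\in\operatorname{conv}(Z^t)\ (t\in\mathcal T),\ \sum_{t=1}^T\mathbf y^t\in T\Psi\Big\},\qquad \eta^t=\min\Big\{\tfrac1m,\tfrac1{\sqrt{mt}}\Big\}.$$ Let $\mathcal T$ be partitioned into nonempty groups $\mathcal T^1,\dots,\mathcal T^K$. Let $w^k$ be the 1-Wasserstein distance between the uniform distributions on $\mathcal T$ and on $\mathcal T^k$ for the distance $d_{ij}=\sum_{t=\min(i,j)}^{\max(i,j)-1}\eta^t$ on $\mathcal T$, that is, $$w^k=\min\Big\{\sum_{i\in\mathcal T^k}\sum_{j\in\mathcal T}d_{ij}q_{ij}:\ q\ge 0,\ \sum_{i\in\mathcal T^k}q_{ij}=\tfrac1T\ (j\in\mathcal T),\ \sum_{j\in\mathcal T}q_{ij}=\tfrac1{|\mathcal T^k|}\ (i\in\mathcal T^k)\Big\},$$ and let $W=\sum_{k=1}^K m\,|\mathcal T^k|\,w^k$. Let $\pi$ be uniformly distributed on the set of permutations of $\mathcal T$ that map each $\mathcal T^k$ to itself (the grouped random permutation model), and let $\Omega^t=Z^{\pi(t)}$ be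 revealed at time $t$. Starting from $\mathbf p^1=\mathbf 0$, for $t=1,\dots,T$ let $$(\hat r^t,\hat{\mathbf x}^t,\hat{\mathbf y}^t)\in\arg\max\{r-(\mathbf p^t)^\top\mathbf y:(r,\mathbf x,\mathbf y)\in\Omega^t\},\qquad \hat{\mathbf v}^t\in\arg\max_{\mathbf v\in Q}(\mathbf p^t)^\top\mathbf v,$$ $$\mathbf p^{t+1}=\operatorname{proj}_{C^\circ}\big(\mathbf p^t-\eta^t(\hat{\mathbf v}^t-\hat{\mathbf y}^t)\big),$$ where $C^\circ=\{\mathbf u:\mathbf u^\top\mathbf v\le 0\ \forall \mathbf v\in C\}$, $\operatorname{proj}$ is the Euclidean projection, and the choices of maximizers made at time $t$ depend only on $\pi(1),\dots,\pi(t)$. Then for every $\rho\in(0,1]$, with probability at least $1-\rho$, $$\sum_{t=1}^T\hat r^t\ \ge\ z^R-c\Big(W+\big(\sqrt{m\log m}+\sqrt{m\log(T/\rho)}\big)\sum_{k=1}^K\sqrt{|\mathcal T^k|}\Big).$$ -/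

import Mathlib

open scoped Pointwise

/-- `ℝ^d` with the Euclidean norm. -/
abbrev Vec (d : ℕ) : Type := EuclideanSpace ℝ (Fin d)

/-- A local decision `(r, x, y)`: reward `r`, auxiliary vector `x ∈ ℝ^d`, impact `y ∈ ℝ^m`. -/
abbrev LocalPoint (d m : ℕ) : Type := ℝ × Vec d × Vec m

/-- The reward component `r`. -/
def LocalPoint.reward {d m : ℕ} (w : LocalPoint d m) : ℝ := w.1

/-- The impact component `y`. -/
def LocalPoint.impact {d m : ℕ} (w : LocalPoint d m) : Vec m := w.2.2

/-- Data of an online decision making problem with `T` time steps and an `m`-dimensional impact: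
the local feasible sets (the dimension of the auxiliary variable may vary with the time step), and
the set `Q` and the closed convex cone `C` whose Minkowski sum is the goal set.
Time step `t ∈ {1, …, T}` is represented by `t - 1 : Fin T`. -/
structure ODMP (T m : ℕ) where
  dim : Fin T → ℕ
  localSet : (t : Fin T) → Set (LocalPoint (dim t) m)
  Q : Set (Vec m)
  C : ProperCone ℝ (Vec m)

namespace ODMP

variable {T m : ℕ}

/-- The goal set `Ψ = Q + C`. -/
def goalSet (I : ODMP T m) : Set (Vec m) := I.Q + (I.C : Set (Vec m))

/-- The problem whose local set at time `t` is `Z^{π(t)}`. -/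
def permute (I : ODMP T m) (π : Equiv.Perm (Fin T)) : ODMP T m where
  dim t := I.dim (π t)
  localSet t := I.localSet (π t)
  Q := I.Q
  C := I.C

/-- The problem is feasible, the local sets are compact, and `Q` is compact and convex. -/
structure BasicAssumption (I : ODMP T m) : Prop where
  feasible : ∃ w : (t : Fin T) → LocalPoint (I.dim t) m,
    (∀ t, w t ∈ I.localSet t) ∧ ∑ t, (w t).impact ∈ (T : ℝ) • I.goalSet
  compact_localSet : ∀ t, IsCompact (I.localSet t)
  compact_Q : IsCompact I.Q
  convex_Q : Convex ℝ I.Q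

/-- Boundedness of the impacts relative to `Q` in the sup norm, and strong feasibility of the
convexified local sets, with constants `dy`, `dr` and `dlow`. -/
structure SlaterAssumption (I : ODMP T m) (dy dr dlow : ℝ) : Prop where
  impact_bound : ∀ t, ∀ w ∈ I.localSet t, ∀ v ∈ I.Q, ∀ i, |w.impact i - v i| ≤ dy
  strongly_feasible : ∀ t, ∃ u ∈ convexHull ℝ (I.localSet t),
    (∀ w ∈ I.localSet t, w.reward - dr ≤ u.reward) ∧
      Metric.closedBall u.impact dlow ⊆ I.goalSet

/-- The optimal value `z^R` of the relaxation in which each local set is replaced by its convex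
hull. (For a feasible problem with compact local sets and compact `Q` the supremum is a maximum.) -/
noncomputable def relaxedValue (I : ODMP T m) : ℝ :=
  sSup {z : ℝ | ∃ w : (t : Fin T) → LocalPoint (I.dim t) m,
    (∀ t, w t ∈ convexHull ℝ (I.localSet t)) ∧
      ∑ t, (w t).impact ∈ (T : ℝ) • I.goalSet ∧ z = ∑ t, (w t).reward}

/-- The polar cone `C° = {u : ⟪u, v⟫ ≤ 0 for all v ∈ C}`. -/
def polarCone (I : ODMP T m) : Set (Vec m) := {u | ∀ v ∈ I.C, inner ℝ u v ≤ 0}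

/-- Everything the algorithm produces: local decisions, points of `Q`, and the dual multipliers
`p^1, …, p^{T+1}` (`p^t` is `p (t - 1)`). -/
structure Trajectory (I : ODMP T m) where
  dec : (t : Fin T) → LocalPoint (I.dim t) m
  v : Fin T → Vec m
  p : Fin (T + 1) → Vec m

/-- `q` is the Euclidean projection of `z` onto `S`. -/
def IsProjection (S : Set (Vec m)) (z q : Vec m) : Prop :=
  q ∈ S ∧ ∀ s ∈ S, dist z q ≤ dist z s

/-- `τ` is a run of the Fenchel dual-based algorithm on `I` with step sizes `η`
(`η t` is the step size of time step `t ∈ {1, …, T}`). -/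
structure IsRun (I : ODMP T m) (η : ℕ → ℝ) (τ : I.Trajectory) : Prop where
  init : τ.p 0 = 0
  dec_mem : ∀ t, τ.dec t ∈ I.localSet t
  dec_max : ∀ t, ∀ w ∈ I.localSet t,
    w.reward - inner ℝ (τ.p t.castSucc) w.impact ≤
      (τ.dec t).reward - inner ℝ (τ.p t.castSucc) (τ.dec t).impact
  v_mem : ∀ t, τ.v t ∈ I.Q
  v_max : ∀ t, ∀ u ∈ I.Q, inner ℝ (τ.p t.castSucc) u ≤ inner ℝ (τ.p t.castSucc) (τ.v t)
  step : ∀ t : Fin T, IsProjection I.polarCone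
    (τ.p t.castSucc - η ((t : ℕ) + 1) • (τ.v t - (τ.dec t).impact)) (τ.p t.succ)

/-- The accumulated reward. -/
noncomputable def Trajectory.totalReward {I : ODMP T m} (τ : I.Trajectory) : ℝ :=
  ∑ t, (τ.dec t).reward

end ODMP

/-- The step size `η^t = min {1/m, 1/√(m t)}`. -/
noncomputable def stepSize (m t : ℕ) : ℝ := min (1 / (m : ℝ)) (1 / √((m : ℝ) * t))

/-- The distance between two time steps: the sum of the step sizes from the earlier one to the
one just before the later one. -/
noncomputable def timeDist {T : ℕ} (η : ℕ → ℝ) (i j : Fin T) : ℝ :=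
  if i < j then ∑ t ∈ Finset.Ico i j, η ((t : ℕ) + 1) else ∑ t ∈ Finset.Ico j i, η ((t : ℕ) + 1)

/-- The 1-Wasserstein distance between the uniform distributions on all time steps and on the group
`B`: the optimal value of the optimal transportation linear program. -/
noncomputable def groupWasserstein {T : ℕ} (η : ℕ → ℝ) (B : Finset (Fin T)) : ℝ :=
  sInf {c : ℝ | ∃ q : B → Fin T → ℝ, (∀ (i : B) (j : Fin T), 0 ≤ q i j) ∧
    (∀ j, ∑ i : B, q i j = 1 / (T : ℝ)) ∧ (∀ i, ∑ j, q i j = 1 / (B.card : ℝ)) ∧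
    c = ∑ i : B, ∑ j, timeDist η (i : Fin T) j * q i j}

/-- The unevenness measure `W = ∑ₖ m |𝒯ᵏ| wᵏ` of a partition of the time steps. -/
noncomputable def unevenness {T : ℕ} (m : ℕ) (η : ℕ → ℝ)
    (P : Finpartition (Finset.univ : Finset (Fin T))) : ℝ :=
  ∑ B ∈ P.parts, (m : ℝ) * B.card * groupWasserstein η B

open Classical in
/-- The permutations of the time steps that map each group to itself. -/
noncomputable def groupedPerms {T : ℕ} (P : Finpartition (Finset.univ : Finset (Fin T))) :
    Finset (Equiv.Perm (Fin T)) :=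
  Finset.univ.filter fun π => ∀ B ∈ P.parts, ∀ t ∈ B, π t ∈ B

theorem groupedPerms_nonempty {T : ℕ} (P : Finpartition (Finset.univ : Finset (Fin T))) :
    (groupedPerms P).Nonempty :=
  ⟨1, by simp [groupedPerms]⟩

/-- The law of a grouped random permutation: uniform on the permutations preserving each group,
that is, the groups are permuted uniformly and independently of each other. -/
noncomputable def groupedLaw {T : ℕ} (P : Finpartition (Finset.univ : Finset (Fin T))) :
    PMF (Equiv.Perm (Fin T)) :=
  PMF.uniformOfFinset (groupedPerms P) (groupedPerms_nonempty P)

/-- `τ π` is what happens when the arrival order is `π`. The family is non-anticipating: the choices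
made at time `t` (in particular the choice among several optimal solutions) depend only on the
arrivals up to time `t`. The dependent pairs compare decisions whose types have equal dimensions. -/
def NonAnticipating {T m : ℕ} (I : ODMP T m) (P : Finpartition (Finset.univ : Finset (Fin T)))
    (τ : (π : Equiv.Perm (Fin T)) → (I.permute π).Trajectory) : Prop :=
  ∀ π ∈ groupedPerms P, ∀ π' ∈ groupedPerms P, ∀ t : Fin T, (∀ s ≤ t, π s = π' s) →
    (⟨_, (τ π).dec t⟩ : Σ d, LocalPoint d m) = ⟨_, (τ π').dec t⟩ ∧ (τ π).v t = (τ π').v t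

/-! Fix nearly optimal convexified decisions `w t` and write their mean impact as `u + c` with `u ∈
Q`, `c ∈ C`. The vectors `a t = (w t).impact - u` then sum to `T • c`. Each online decision is
optimal against `w (π t)` and each `v t` against `u`, so the loss is at most `∑ ⟪p t, a (π t)⟫ + ∑
⟪p t, v t - (dec t).impact⟫`.

The second sum is the usual projected-subgradient quantity. It is `O(√(mT))` because the strongly
feasible points keep the multipliers bounded (`norm_p_le`, `sum_inner_p_le`).

In the first sum, `a (π t)` is split into three terms. Its deviation from the conditional mean,
which is the mean over the arrivals of its group still to come, is a martingale difference against
the predictable `p t` (`card_inner_tail_le`). The deviation of that conditional mean from the full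
group mean is controlled by Hoeffding's inequality without replacement (`card_avgFrom_tail_le`);
summed over time it gives `∑ √|B|`. There remains the group mean. Since `p` moves by at most `√m *
dy * η` per step, replacing the average of `p` over a group by its overall average costs a transport
distance, in total a multiple of `W` (`sum_inner_group_mean_le`). What is left is `∑ ⟪p t, c⟫ ≤ 0`,
by polarity. -/

section GroupedPermutations

/-! ### Swaps within a group, and Azuma's inequality for grouped permutations. -/

variable {T : ℕ} {P : Finpartition (Finset.univ : Finset (Fin T))}

theorem mem_groupedPerms {π : Equiv.Perm (Fin T)} :
    π ∈ groupedPerms P ↔ ∀ B ∈ P.parts, ∀ t ∈ B, π t ∈ B := by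
  simp [groupedPerms]

theorem mul_swap_mem_groupedPerms {π : Equiv.Perm (Fin T)} (hπ : π ∈ groupedPerms P)
    {B : Finset (Fin T)} (hB : B ∈ P.parts) {s t : Fin T} (ht : t ∈ B) (hs : s ∈ B) :
    π * Equiv.swap t s ∈ groupedPerms P := by
  rw [mem_groupedPerms] at hπ ⊢
  intro B' hB' u hu
  rw [Equiv.Perm.mul_apply]
  refine hπ B' hB' _ ?_
  rcases eq_or_ne u t with rfl | hut
  · rw [Equiv.swap_apply_left, P.eq_of_mem_parts hB' hB hu ht]
    exact hs
  rcases eq_or_ne u s with rfl | hus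
  · rw [Equiv.swap_apply_right, P.eq_of_mem_parts hB' hB hu hs]
    exact ht
  rwa [Equiv.swap_apply_of_ne_of_ne hut hus]

/-- Right multiplication by a swap inside a group is an involution of the group-preserving
permutations. Averaging over swaps of `t` with later members of its group therefore plays the role
of conditional expectation given the arrivals before `t`. -/
theorem sum_groupedPerms_mul_swap {B : Finset (Fin T)} (hB : B ∈ P.parts) {s t : Fin T}
    (ht : t ∈ B) (hs : s ∈ B) (F : Equiv.Perm (Fin T) → ℝ) :
    ∑ π ∈ groupedPerms P, F (π * Equiv.swap t s) = ∑ π ∈ groupedPerms P, F π := by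
  refine Finset.sum_bij' (fun π _ => π * Equiv.swap t s) (fun π _ => π * Equiv.swap t s)
    (fun π hπ => mul_swap_mem_groupedPerms hπ hB ht hs)
    (fun π hπ => mul_swap_mem_groupedPerms hπ hB ht hs) ?_ ?_ (fun _ _ => rfl) <;>
  · intro π _
    rw [mul_assoc, Equiv.swap_mul_self, mul_one]

theorem sum_comp_of_mem_groupedPerms {E : Type*} [AddCommMonoid E] {π : Equiv.Perm (Fin T)}
    (hπ : π ∈ groupedPerms P) {B : Finset (Fin T)} (hB : B ∈ P.parts) (f : Fin T → E) :
    ∑ s ∈ B, f (π s) = ∑ s ∈ B, f s := by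
  have h : B.map π.toEmbedding = B := by
    refine Finset.eq_of_subset_of_card_le ?_ (by simp)
    intro x hx
    obtain ⟨s, hs, rfl⟩ := Finset.mem_map.1 hx
    exact mem_groupedPerms.1 hπ B hB s hs
  conv_rhs => rw [← h, Finset.sum_map]
  rfl

theorem sum_parts_sum {E : Type*} [AddCommMonoid E]
    (P : Finpartition (Finset.univ : Finset (Fin T))) (f : Fin T → E) :
    ∑ B ∈ P.parts, ∑ t ∈ B, f t = ∑ t, f t := by
  have h := Finset.sum_biUnion (f := f) P.disjoint
  rw [P.biUnion_parts] at h
  exact h.symm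

theorem sum_part_eq {E : Type*} [AddCommMonoid E]
    (P : Finpartition (Finset.univ : Finset (Fin T))) (f : Finset (Fin T) → Fin T → E) :
    ∑ t, f (P.part t) t = ∑ B ∈ P.parts, ∑ t ∈ B, f B t := by
  rw [← sum_parts_sum P]
  refine Finset.sum_congr rfl fun B hB => Finset.sum_congr rfl fun t ht => ?_
  rw [P.part_eq_of_mem hB ht]

/-- The members of the group `B` that are not earlier than `n`. -/
def groupFrom (B : Finset (Fin T)) (n : ℕ) : Finset (Fin T) :=
  B.filter fun s => n ≤ (s : ℕ)

theorem mem_groupFrom {B : Finset (Fin T)} {n : ℕ} {s : Fin T} :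
    s ∈ groupFrom B n ↔ s ∈ B ∧ n ≤ (s : ℕ) := by
  simp [groupFrom]

theorem groupFrom_zero (B : Finset (Fin T)) : groupFrom B 0 = B := by
  simp [groupFrom]

theorem self_mem_groupFrom_part (t : Fin T) : t ∈ groupFrom (P.part t) t :=
  mem_groupFrom.2 ⟨P.mem_part_self.2 (Finset.mem_univ t), le_rfl⟩

theorem part_mem_parts (t : Fin T) : P.part t ∈ P.parts :=
  P.part_mem.2 (Finset.mem_univ t)

theorem groupFrom_eq_insert {B : Finset (Fin T)} {t : Fin T} (ht : t ∈ B) :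
    groupFrom B t = insert t (groupFrom B (t + 1)) := by
  ext s
  simp only [mem_groupFrom, Finset.mem_insert, Fin.ext_iff]
  constructor
  · rintro ⟨h1, h2⟩
    rcases eq_or_lt_of_le h2 with h | h
    · exact Or.inl h.symm
    · exact Or.inr ⟨h1, h⟩
  · rintro (h | ⟨h1, h2⟩)
    · obtain rfl : s = t := Fin.ext h
      exact ⟨ht, le_rfl⟩
    · exact ⟨h1, by omega⟩

theorem notMem_groupFrom_succ (B : Finset (Fin T)) (t : Fin T) :
    t ∉ groupFrom B (t + 1) := by
  simp [mem_groupFrom]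

theorem groupFrom_succ_of_notMem {B : Finset (Fin T)} {t : Fin T} (ht : t ∉ B) :
    groupFrom B (t + 1) = groupFrom B t := by
  ext s
  simp only [mem_groupFrom]
  refine and_congr_right fun hs => ?_
  have : (s : ℕ) ≠ t := fun h => ht (Fin.ext h ▸ hs)
  omega

theorem card_groupFrom_of_mem {B : Finset (Fin T)} {t : Fin T} (ht : t ∈ B) :
    (groupFrom B t).card = (groupFrom B (t + 1)).card + 1 := by
  rw [groupFrom_eq_insert ht, Finset.card_insert_of_notMem (notMem_groupFrom_succ B t)]

/-- If the members of `B` not earlier than `n` are rearranged, their sum is unchanged. -/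
theorem sum_groupFrom_mul_swap {E : Type*} [AddCommMonoid E] {B : Finset (Fin T)} {n : ℕ}
    {s t : Fin T} (ht : t ∈ groupFrom B n) (hs : s ∈ groupFrom B n)
    (π : Equiv.Perm (Fin T)) (f : Fin T → E) :
    ∑ u ∈ groupFrom B n, f ((π * Equiv.swap t s) u) = ∑ u ∈ groupFrom B n, f (π u) := by
  refine Finset.sum_equiv (Equiv.swap t s) (fun u => ?_) (fun u _ => rfl)
  rcases eq_or_ne u t with rfl | hut
  · simp [ht, hs]
  rcases eq_or_ne u s with rfl | hus
  · simp [ht, hs]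
  rw [Equiv.swap_apply_of_ne_of_ne hut hus]

/-- The total over a group is fixed, so what has already arrived determines the sum of what is still
to come. This makes `avgFrom B n` predictable. -/
theorem sum_groupFrom_congr {E : Type*} [AddCommGroup E] {B : Finset (Fin T)}
    (hB : B ∈ P.parts) {n : ℕ} {π π' : Equiv.Perm (Fin T)} (hπ : π ∈ groupedPerms P)
    (hπ' : π' ∈ groupedPerms P) (h : ∀ s : Fin T, (s : ℕ) < n → π s = π' s) (f : Fin T → E) :
    ∑ u ∈ groupFrom B n, f (π u) = ∑ u ∈ groupFrom B n, f (π' u) := by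
  have h1 := Finset.sum_filter_add_sum_filter_not B (fun s : Fin T => n ≤ (s : ℕ))
    (fun s => f (π s))
  have h2 := Finset.sum_filter_add_sum_filter_not B (fun s : Fin T => n ≤ (s : ℕ))
    (fun s => f (π' s))
  rw [sum_comp_of_mem_groupedPerms hπ hB] at h1
  rw [sum_comp_of_mem_groupedPerms hπ' hB, ← h1] at h2
  have h3 : ∑ s ∈ B with ¬ n ≤ s.val, f (π s) = ∑ s ∈ B with ¬ n ≤ s.val, f (π' s) :=
    Finset.sum_congr rfl fun s hs => by
      rw [h s (not_le.1 (Finset.mem_filter.1 hs).2)]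
  rw [h3] at h2
  exact (add_right_cancel h2).symm

/-- The mean of `f ∘ π` over the members of `B` that are not earlier than `n`. -/
noncomputable def avgFrom {E : Type*} [AddCommGroup E] [Module ℝ E] (B : Finset (Fin T)) (n : ℕ)
    (f : Fin T → E) (π : Equiv.Perm (Fin T)) : E :=
  ((groupFrom B n).card : ℝ)⁻¹ • ∑ s ∈ groupFrom B n, f (π s)

/-- Hoeffding's lemma for the uniform distribution on a finite set. -/
theorem sum_exp_le_of_sum_eq_zero {ι : Type*} (R : Finset ι) (x : ι → ℝ) (v : ℝ)
    (h0 : ∑ i ∈ R, x i = 0) (hv : ∀ i ∈ R, x i ^ 2 ≤ v) (l : ℝ) :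
    ∑ i ∈ R, Real.exp (l * x i) ≤ R.card * Real.exp (l ^ 2 / 2 * v) := by
  rcases R.eq_empty_or_nonempty with rfl | ⟨i₀, hi₀⟩
  · simp
  have hv0 : 0 ≤ v := (sq_nonneg _).trans (hv i₀ hi₀)
  -- The chord argument below divides by `M = √v`.
  rcases hv0.eq_or_lt with rfl | hvpos
  · have : ∀ i ∈ R, Real.exp (l * x i) = 1 := fun i hi => by
      have : x i = 0 := by
        have := hv i hi
        exact pow_eq_zero_iff two_ne_zero |>.1 (le_antisymm this (sq_nonneg _))
      simp [this]
    rw [Finset.sum_congr rfl this]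
    simp
  set M := √v
  have hM : 0 < M := Real.sqrt_pos.2 hvpos
  have hM2 : M ^ 2 = v := Real.sq_sqrt hv0
  -- Convexity: on `[-M, M]` the exponential lies below its chord. The linear part of the chord
  -- disappears on summation.
  have key : ∀ i ∈ R, Real.exp (l * x i) ≤
      Real.cosh (l * M) + x i * (Real.sinh (l * M) / M) := fun i hi => by
    have habs : |x i| ≤ M := Real.abs_le_sqrt (hv i hi)
    obtain ⟨hl, hu⟩ := abs_le.1 habs
    have hc := convexOn_exp.2 (Set.mem_univ (l * M)) (Set.mem_univ (-(l * M)))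
      (show 0 ≤ (M + x i) / (2 * M) from div_nonneg (by linarith) (by positivity))
      (show 0 ≤ (M - x i) / (2 * M) from div_nonneg (by linarith) (by positivity))
      (by field_simp; ring)
    have e1 : (M + x i) / (2 * M) * (l * M) + (M - x i) / (2 * M) * (-(l * M)) = l * x i := by
      field_simp; ring
    simp only [smul_eq_mul] at hc
    rw [e1] at hc
    refine hc.trans (le_of_eq ?_)
    rw [Real.cosh_eq, Real.sinh_eq]
    field_simp; ring
  calc ∑ i ∈ R, Real.exp (l * x i)
      ≤ ∑ i ∈ R, (Real.cosh (l * M) + x i * (Real.sinh (l * M) / M)) := Finset.sum_le_sum key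
    _ = R.card * Real.cosh (l * M) := by
        rw [Finset.sum_add_distrib, ← Finset.sum_mul, h0]; simp
    _ ≤ _ := by
        refine mul_le_mul_of_nonneg_left ((Real.cosh_le_exp_half_sq _).trans (le_of_eq ?_))
          (Nat.cast_nonneg _)
        rw [mul_pow, hM2]; ring_nf

/-- Azuma's inequality for grouped random permutations, in terms of the moment generating
function. -/
theorem sum_exp_groupedPerms_le (X : Fin T → Equiv.Perm (Fin T) → ℝ) (v : Fin T → ℝ)
    (hX : ∀ t, ∀ π ∈ groupedPerms P, ∀ π' ∈ groupedPerms P, (∀ s ≤ t, π s = π' s) →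
      X t π = X t π')
    (h0 : ∀ t, ∀ π ∈ groupedPerms P,
      ∑ s ∈ groupFrom (P.part t) t, X t (π * Equiv.swap t s) = 0)
    (hv : ∀ t, ∀ π ∈ groupedPerms P, X t π ^ 2 ≤ v t) (l : ℝ) :
    ∑ π ∈ groupedPerms P, Real.exp (l * ∑ t, X t π) ≤
      (groupedPerms P).card * Real.exp (l ^ 2 / 2 * ∑ t, v t) := by
  suffices H : ∀ n ≤ T, ∑ π ∈ groupedPerms P, Real.exp (l * ∑ t with t.val < n, X t π) ≤
      (groupedPerms P).card * Real.exp (l ^ 2 / 2 * ∑ t with t.val < n, v t) by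
    simpa using H T le_rfl
  intro n
  induction n with
  | zero => intro _; simp
  | succ n ih =>
    intro hn
    set t : Fin T := ⟨n, hn⟩
    have hsplit : (Finset.univ.filter fun u : Fin T => u.val < n + 1) =
        insert t (Finset.univ.filter fun u : Fin T => u.val < n) := by
      ext u
      simp only [Finset.mem_filter, Finset.mem_univ, true_and, Finset.mem_insert, Fin.ext_iff, t]
      omega
    have hnot : t ∉ Finset.univ.filter fun u : Fin T => u.val < n := by simp [t]
    simp only [hsplit, Finset.sum_insert hnot]
    set F : Equiv.Perm (Fin T) → ℝ := fun π => Real.exp (l * ∑ u with u.val < n, X u π) with hF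
    set R := groupFrom (P.part t) t with hR
    have hRpos : (0 : ℝ) < R.card := by
      exact_mod_cast Finset.card_pos.2 ⟨t, self_mem_groupFrom_part t⟩
    have hmem : ∀ s ∈ R, ∀ π ∈ groupedPerms P, π * Equiv.swap t s ∈ groupedPerms P :=
      fun s hs π hπ => mul_swap_mem_groupedPerms hπ (part_mem_parts t)
        (P.mem_part_self.2 (Finset.mem_univ t)) (mem_groupFrom.1 hs).1
    -- A swap of `t` with a later time leaves all arrivals before `t` in place, and `F` depends on
    -- these alone.
    have hFinv : ∀ s ∈ R, ∀ π ∈ groupedPerms P, F (π * Equiv.swap t s) = F π := by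
      intro s hs π hπ
      simp only [hF]
      congr 2
      refine Finset.sum_congr rfl fun u hu => hX u _ (hmem s hs π hπ) _ hπ fun w hw => ?_
      have hu' : u.val < n := (Finset.mem_filter.1 hu).2
      have hs' : n ≤ s.val := (mem_groupFrom.1 hs).2
      have hw' : w.val ≤ u.val := hw
      rw [Equiv.Perm.mul_apply, Equiv.swap_apply_of_ne_of_ne]
      · rintro rfl; simp only [t] at hw'; omega
      · rintro rfl; omega
    have hexp : ∀ π, Real.exp (l * (X t π + ∑ u with u.val < n, X u π)) =
        F π * Real.exp (l * X t π) := fun π => by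
      rw [hF, ← Real.exp_add]; ring_nf
    simp only [hexp]
    -- The tower property: the last factor is averaged over the swaps while `F` stays fixed, which
    -- reduces the step to Hoeffding's lemma on `R`.
    have havg : (R.card : ℝ) * ∑ π ∈ groupedPerms P, F π * Real.exp (l * X t π) =
        ∑ π ∈ groupedPerms P, F π * ∑ s ∈ R, Real.exp (l * X t (π * Equiv.swap t s)) := by
      simp only [Finset.mul_sum (s := R)]
      rw [Finset.sum_comm, ← nsmul_eq_mul, ← Finset.sum_const]
      refine Finset.sum_congr rfl fun s hs => ?_
      rw [← sum_groupedPerms_mul_swap (part_mem_parts t)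
        (P.mem_part_self.2 (Finset.mem_univ t)) (mem_groupFrom.1 hs).1]
      exact Finset.sum_congr rfl fun π hπ => by rw [hFinv s hs π hπ]
    have hle : (R.card : ℝ) * ∑ π ∈ groupedPerms P, F π * Real.exp (l * X t π) ≤
        R.card * ((groupedPerms P).card *
          Real.exp (l ^ 2 / 2 * (v t + ∑ u with u.val < n, v u))) := by
      rw [havg]
      calc _ ≤ ∑ π ∈ groupedPerms P, F π * (R.card * Real.exp (l ^ 2 / 2 * v t)) := by
            refine Finset.sum_le_sum fun π hπ =>
              mul_le_mul_of_nonneg_left ?_ (Real.exp_pos _).le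
            exact sum_exp_le_of_sum_eq_zero R _ (v t) (h0 t π hπ)
              (fun s hs => hv t _ (hmem s hs π hπ)) l
        _ = R.card * Real.exp (l ^ 2 / 2 * v t) * ∑ π ∈ groupedPerms P, F π := by
            rw [← Finset.sum_mul]; ring
        _ ≤ R.card * Real.exp (l ^ 2 / 2 * v t) * ((groupedPerms P).card *
              Real.exp (l ^ 2 / 2 * ∑ u with u.val < n, v u)) :=
            mul_le_mul_of_nonneg_left (ih (by omega)) (by positivity)
        _ = _ := by rw [mul_add, Real.exp_add]; ring
    exact le_of_mul_le_mul_left hle hRpos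

open Classical in
/-- Azuma's inequality for grouped random permutations. -/
theorem card_groupedPerms_tail_le (X : Fin T → Equiv.Perm (Fin T) → ℝ) (v : Fin T → ℝ)
    (hX : ∀ t, ∀ π ∈ groupedPerms P, ∀ π' ∈ groupedPerms P, (∀ s ≤ t, π s = π' s) →
      X t π = X t π')
    (h0 : ∀ t, ∀ π ∈ groupedPerms P,
      ∑ s ∈ groupFrom (P.part t) t, X t (π * Equiv.swap t s) = 0)
    (hv : ∀ t, ∀ π ∈ groupedPerms P, X t π ^ 2 ≤ v t) {V L : ℝ} (hV : 0 < V)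
    (hsum : ∑ t, v t ≤ V) (hL : 0 ≤ L) :
    (((groupedPerms P).filter fun π => √(2 * V * L) < ∑ t, X t π).card : ℝ) ≤
      (groupedPerms P).card * Real.exp (-L) := by
  set ε := √(2 * V * L) with hε
  have hε2 : ε ^ 2 = 2 * V * L := Real.sq_sqrt (by positivity)
  have hε0 : 0 ≤ ε := Real.sqrt_nonneg _
  -- This is the minimizer of the Chernoff exponent `l ^ 2 / 2 * V - l * ε`, whose value there is
  -- `-L`.
  set l := ε / V
  have hl : 0 ≤ l := by positivity
  have h1 := sum_exp_groupedPerms_le X v hX h0 hv l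
  have h2 : (((groupedPerms P).filter fun π => ε < ∑ t, X t π).card : ℝ) * Real.exp (l * ε) ≤
      ∑ π ∈ groupedPerms P, Real.exp (l * ∑ t, X t π) := by
    rw [← nsmul_eq_mul, ← Finset.sum_const]
    refine (Finset.sum_le_sum fun π hπ => ?_).trans
      (Finset.sum_le_sum_of_subset_of_nonneg (Finset.filter_subset _ _)
        fun _ _ _ => (Real.exp_pos _).le)
    exact Real.exp_le_exp.2 (mul_le_mul_of_nonneg_left (Finset.mem_filter.1 hπ).2.le hl)
  have h3 : Real.exp (l ^ 2 / 2 * ∑ t, v t) ≤ Real.exp (l ^ 2 / 2 * V) :=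
    Real.exp_le_exp.2 (mul_le_mul_of_nonneg_left hsum (by positivity))
  have h4 : Real.exp (l ^ 2 / 2 * V) = Real.exp (-L) * Real.exp (l * ε) := by
    rw [← Real.exp_add]
    congr 1
    have : l ^ 2 * V = 2 * L := by
      simp only [l]; rw [div_pow, hε2]; field_simp
    have h' : l * ε = 2 * L := by
      simp only [l]; rw [div_mul_eq_mul_div, ← sq, hε2]; field_simp
    rw [h']; linarith
  refine le_of_mul_le_mul_right ?_ (Real.exp_pos (l * ε))
  calc _ ≤ _ := h2
    _ ≤ _ := h1
    _ ≤ _ := mul_le_mul_of_nonneg_left h3 (Nat.cast_nonneg _)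
    _ = _ := by rw [h4]; ring

end GroupedPermutations

/-! ### Concentration for sampling without replacement. -/

section SamplingWithoutReplacement

variable {T : ℕ} {P : Finpartition (Finset.univ : Finset (Fin T))}

theorem norm_inv_card_smul_sum_le {ι E : Type*} [NormedAddCommGroup E] [NormedSpace ℝ E]
    (S : Finset ι) (f : ι → E) {A : ℝ} (hA : 0 ≤ A) (hf : ∀ i ∈ S, ‖f i‖ ≤ A) :
    ‖(S.card : ℝ)⁻¹ • ∑ i ∈ S, f i‖ ≤ A := by
  rcases S.eq_empty_or_nonempty with rfl | hS
  · simpa using hA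
  have hpos : (0 : ℝ) < S.card := by exact_mod_cast hS.card_pos
  rw [norm_smul, norm_inv, Real.norm_natCast, inv_mul_le_iff₀ hpos]
  refine (norm_sum_le _ _).trans ((Finset.sum_le_sum hf).trans ?_)
  rw [Finset.sum_const, nsmul_eq_mul]

theorem norm_avgFrom_le {E : Type*} [NormedAddCommGroup E] [NormedSpace ℝ E]
    (B : Finset (Fin T)) (n : ℕ) {a : Fin T → E} {A : ℝ} (ha : ∀ s, ‖a s‖ ≤ A) (hA : 0 ≤ A)
    (π : Equiv.Perm (Fin T)) : ‖avgFrom B n a π‖ ≤ A :=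
  norm_inv_card_smul_sum_le _ _ hA fun _ _ => ha _

theorem avgFrom_congr {E : Type*} [AddCommGroup E] [Module ℝ E] {B : Finset (Fin T)}
    (hB : B ∈ P.parts) {n : ℕ} {π π' : Equiv.Perm (Fin T)} (hπ : π ∈ groupedPerms P)
    (hπ' : π' ∈ groupedPerms P) (h : ∀ s : Fin T, (s : ℕ) < n → π s = π' s) (f : Fin T → E) :
    avgFrom B n f π = avgFrom B n f π' := by
  rw [avgFrom, avgFrom, sum_groupFrom_congr hB hπ hπ' h]

theorem avgFrom_mul_swap {E : Type*} [AddCommGroup E] [Module ℝ E] {B : Finset (Fin T)} {n : ℕ}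
    {s t : Fin T} (ht : t ∈ groupFrom B n) (hs : s ∈ groupFrom B n)
    (π : Equiv.Perm (Fin T)) (f : Fin T → E) :
    avgFrom B n f (π * Equiv.swap t s) = avgFrom B n f π := by
  rw [avgFrom, avgFrom, sum_groupFrom_mul_swap ht hs]

theorem avgFrom_zero {E : Type*} [AddCommGroup E] [Module ℝ E] {B : Finset (Fin T)}
    (hB : B ∈ P.parts) {π : Equiv.Perm (Fin T)} (hπ : π ∈ groupedPerms P) (f : Fin T → E) :
    avgFrom B 0 f π = (B.card : ℝ)⁻¹ • ∑ s ∈ B, f s := by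
  rw [avgFrom, groupFrom_zero, sum_comp_of_mem_groupedPerms hπ hB]

open Classical in
/-- Concentration of the inner products of predictable vectors with the deviations of the arrivals
from their conditional means. -/
theorem card_inner_tail_le {E : Type*} [NormedAddCommGroup E] [InnerProductSpace ℝ E]
    (hT : 0 < T) (p : Fin T → Equiv.Perm (Fin T) → E) (a : Fin T → E) {A b L : ℝ}
    (hp : ∀ t, ∀ π ∈ groupedPerms P, ∀ π' ∈ groupedPerms P, (∀ s < t, π s = π' s) →
      p t π = p t π')
    (hb : ∀ t, ∀ π ∈ groupedPerms P, ‖p t π‖ ≤ b) (ha : ∀ s, ‖a s‖ ≤ A)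
    (hA : 0 < A) (hb0 : 0 < b) (hL : 0 ≤ L) :
    (((groupedPerms P).filter fun π => √(2 * (T * (b * (2 * A)) ^ 2) * L) <
        ∑ t, inner ℝ (p t π) (a (π t) - avgFrom (P.part t) t a π)).card : ℝ) ≤
      (groupedPerms P).card * Real.exp (-L) := by
  have hT' : (1 : ℝ) ≤ T := by exact_mod_cast hT
  have hmem : ∀ t : Fin T, ∀ s ∈ groupFrom (P.part t) t, ∀ π ∈ groupedPerms P,
      π * Equiv.swap t s ∈ groupedPerms P :=
    fun t s hs π hπ => mul_swap_mem_groupedPerms hπ (part_mem_parts t)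
      (P.mem_part_self.2 (Finset.mem_univ t)) (mem_groupFrom.1 hs).1
  refine card_groupedPerms_tail_le
    (fun t π => inner ℝ (p t π) (a (π t) - avgFrom (P.part t) t a π))
    (fun _ => (b * (2 * A)) ^ 2) ?_ ?_ ?_ (by positivity) ?_ hL
  · intro t π hπ π' hπ' h
    rw [hp t π hπ π' hπ' fun s hs => h s hs.le, h t le_rfl,
      avgFrom_congr (part_mem_parts t) hπ hπ' fun s hs => h s (le_of_lt hs)]
  · intro t π hπ
    have hself := self_mem_groupFrom_part (P := P) t
    have hcard : ((groupFrom (P.part t) t).card : ℝ) ≠ 0 := by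
      exact_mod_cast (Finset.card_pos.2 ⟨t, hself⟩).ne'
    -- The swap changes neither the predictable `p t` nor the mean of the remaining arrivals; only
    -- `a (π t)` becomes `a (π s)`. The sum over `s` is then a sum of deviations from their own
    -- mean.
    have : ∀ s ∈ groupFrom (P.part t) t,
        inner ℝ (p t (π * Equiv.swap t s)) (a ((π * Equiv.swap t s) t) -
          avgFrom (P.part t) t a (π * Equiv.swap t s)) =
        inner ℝ (p t π) (a (π s) - avgFrom (P.part t) t a π) := fun s hs => by
      rw [avgFrom_mul_swap hself hs, Equiv.Perm.mul_apply, Equiv.swap_apply_left,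
        hp t _ (hmem t s hs π hπ) π hπ]
      intro u hu
      have h2 : t ≤ s := (mem_groupFrom.1 hs).2
      rw [Equiv.Perm.mul_apply,
        Equiv.swap_apply_of_ne_of_ne hu.ne (hu.trans_le h2).ne]
    rw [Finset.sum_congr rfl this, ← inner_sum, Finset.sum_sub_distrib, Finset.sum_const, avgFrom,
      ← Nat.cast_smul_eq_nsmul ℝ, smul_inv_smul₀ hcard, sub_self, inner_zero_right]
  · intro t π hπ
    rw [← sq_abs]
    refine pow_le_pow_left₀ (abs_nonneg _) ((abs_real_inner_le_norm _ _).trans ?_) 2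
    refine mul_le_mul (hb t π hπ) ?_ (norm_nonneg _) hb0.le
    refine (norm_sub_le _ _).trans ?_
    linarith [ha (π t), norm_avgFrom_le (P.part t) t ha hA.le π]
  · rw [Finset.sum_const, Finset.card_univ, Fintype.card_fin, nsmul_eq_mul]

theorem sum_ite_lt_sub (g : ℕ → ℝ) (t₀ : Fin T) :
    ∑ t : Fin T, (if t < t₀ then g (t + 1) - g t else 0) = g t₀ - g 0 := by
  have h := Fin.sum_univ_eq_sum_range (fun n => if n < (t₀ : ℕ) then g (n + 1) - g n else 0) T
  simp only [Fin.lt_def]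
  rw [← Finset.sum_range_sub, h, ← Finset.sum_filter]
  refine Finset.sum_congr ?_ fun _ _ => rfl
  ext n
  simp only [Finset.mem_filter, Finset.mem_range]
  have := t₀.2
  omega

/-- Deleting one of `k + 1` values moves the mean by `1 / k` times the deviation of that value from
it. Nonemptiness excludes `k = 0`, where the later mean takes the default value `0`. -/
theorem avgFrom_succ_sub {B : Finset (Fin T)} {t : Fin T} (ht : t ∈ B)
    (hne : (groupFrom B (t + 1)).Nonempty) (f : Fin T → ℝ) (π : Equiv.Perm (Fin T)) :
    avgFrom B (t + 1) f π - avgFrom B t f π =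
      ((groupFrom B (t + 1)).card : ℝ)⁻¹ * (avgFrom B t f π - f (π t)) := by
  have hk : (0 : ℝ) < (groupFrom B (t + 1)).card := by exact_mod_cast hne.card_pos
  rw [avgFrom, avgFrom, card_groupFrom_of_mem ht, groupFrom_eq_insert ht,
    Finset.sum_insert (notMem_groupFrom_succ B t)]
  push_cast
  simp only [smul_eq_mul]
  field_simp
  ring

open Classical in
/-- Hoeffding's inequality for sampling without replacement: the mean of the arrivals of a group
that are still to come is close to the mean of the group. -/
theorem card_avgFrom_tail_le (f : Fin T → ℝ) {D L : ℝ} (hf : ∀ s, |f s| ≤ D) (hD : 0 < D)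
    (hL : 0 ≤ L) (t₀ : Fin T) :
    (((groupedPerms P).filter fun π =>
        √(2 * (8 * D ^ 2 * ((groupFrom (P.part t₀) t₀).card : ℝ)⁻¹) * L) <
          avgFrom (P.part t₀) t₀ f π - avgFrom (P.part t₀) 0 f π).card : ℝ) ≤
      (groupedPerms P).card * Real.exp (-L) := by
  set B := P.part t₀ with hBdef
  have hB : B ∈ P.parts := part_mem_parts t₀
  set N : ℕ → ℝ := fun n => (groupFrom B n).card with hN
  have hself : t₀ ∈ groupFrom B t₀ := self_mem_groupFrom_part t₀
  have hN0 : 0 < N t₀ := by simp only [hN]; exact_mod_cast Finset.card_pos.2 ⟨t₀, hself⟩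
  have hne : ∀ t < t₀, (groupFrom B (t + 1)).Nonempty := fun t ht =>
    ⟨t₀, mem_groupFrom.2 ⟨(mem_groupFrom.1 hself).1, ht⟩⟩
  have hstay : ∀ t ∉ B, ∀ π, avgFrom B (t + 1) f π = avgFrom B t f π := fun t ht π => by
    rw [avgFrom, avgFrom, groupFrom_succ_of_notMem ht]
  have hfn : ∀ s, ‖f s‖ ≤ D := hf
  -- The mean of the remaining arrivals is a martingale, stopped here at `t₀`. With `k` members left
  -- after `t`, its increment squared is at most `(2 * D) ^ 2 / k ^ 2 ≤ 8 * D ^ 2 * (1 / k - 1 / (k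
  -- + 1))`. These bounds telescope to at most `8 * D ^ 2 / N t₀`. Times outside `B` contribute
  -- nothing.
  have hmain := card_groupedPerms_tail_le (P := P)
    (fun t π => if t < t₀ then avgFrom B (t + 1) f π - avgFrom B t f π else 0)
    (fun t => 8 * D ^ 2 * (if t < t₀ then (N (t + 1))⁻¹ - (N t)⁻¹ else 0)) ?_ ?_ ?_
    (V := 8 * D ^ 2 * (N t₀)⁻¹) (by positivity) ?_ hL
  · have e : ∀ π, (∑ t, if t < t₀ then avgFrom B (t + 1) f π - avgFrom B t f π else 0) =
        avgFrom B t₀ f π - avgFrom B 0 f π := fun π => sum_ite_lt_sub (fun n => avgFrom B n f π) t₀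
    simp only [e] at hmain
    exact hmain
  · intro t π hπ π' hπ' h
    rw [avgFrom_congr hB hπ hπ' fun s hs => h s (Nat.lt_succ_iff.1 hs),
      avgFrom_congr hB hπ hπ' fun s hs => h s (le_of_lt hs)]
  · intro t π hπ
    by_cases ht : t < t₀
    swap
    · simp [ht]
    simp only [ht, if_true]
    by_cases htB : t ∈ B
    swap
    · simp [hstay t htB]
    rw [P.part_eq_of_mem hB htB]
    have htt : t ∈ groupFrom B t := mem_groupFrom.2 ⟨htB, le_rfl⟩
    have hcard : ((groupFrom B t).card : ℝ) ≠ 0 := by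
      exact_mod_cast (Finset.card_pos.2 ⟨t, htt⟩).ne'
    have : ∀ s ∈ groupFrom B t, avgFrom B (t + 1) f (π * Equiv.swap t s) -
        avgFrom B t f (π * Equiv.swap t s) =
        ((groupFrom B (t + 1)).card : ℝ)⁻¹ * (avgFrom B t f π - f (π s)) := fun s hs => by
      rw [avgFrom_succ_sub htB (hne t ht), avgFrom_mul_swap htt hs, Equiv.Perm.mul_apply,
        Equiv.swap_apply_left]
    rw [Finset.sum_congr rfl this, ← Finset.mul_sum, Finset.sum_sub_distrib, Finset.sum_const,
      avgFrom, ← Nat.cast_smul_eq_nsmul ℝ, smul_inv_smul₀ hcard, sub_self, mul_zero]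
  · intro t π _
    by_cases ht : t < t₀
    swap
    · simp [ht]
    simp only [ht, if_true]
    by_cases htB : t ∈ B
    swap
    · simp [hstay t htB, hN, groupFrom_succ_of_notMem htB]
    have hk : 1 ≤ N (t + 1) := by simp only [hN]; exact_mod_cast (hne t ht).card_pos
    have hNt : N t = N (t + 1) + 1 := by simp only [hN, card_groupFrom_of_mem htB]; push_cast; rfl
    rw [avgFrom_succ_sub htB (hne t ht), hNt]
    change ((N (t + 1))⁻¹ * _) ^ 2 ≤ _
    set k := N (t + 1)
    have hx : (avgFrom B t f π - f (π t)) ^ 2 ≤ (2 * D) ^ 2 := by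
      rw [← sq_abs]
      refine pow_le_pow_left₀ (abs_nonneg _) ((abs_sub _ _).trans ?_) 2
      linarith [hf (π t), norm_avgFrom_le B t hfn hD.le π,
        Real.norm_eq_abs (avgFrom B t f π)]
    have hk' : k⁻¹ - (k + 1)⁻¹ = (k * (k + 1))⁻¹ := by field_simp; ring
    rw [mul_pow, hk']
    calc k⁻¹ ^ 2 * (avgFrom B t f π - f (π t)) ^ 2 ≤ k⁻¹ ^ 2 * (2 * D) ^ 2 :=
          mul_le_mul_of_nonneg_left hx (by positivity)
      _ = 8 * D ^ 2 * (2 * k ^ 2)⁻¹ := by field_simp; ring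
      _ ≤ 8 * D ^ 2 * (k * (k + 1))⁻¹ := by
          refine mul_le_mul_of_nonneg_left (inv_anti₀ (by positivity) (by nlinarith))
            (by positivity)
  · rw [← Finset.mul_sum, sum_ite_lt_sub fun n => (N n)⁻¹]
    refine mul_le_mul_of_nonneg_left ?_ (by positivity)
    have : 0 ≤ (N 0)⁻¹ := by simp only [hN]; positivity
    linarith

/-- Along `B` the cardinalities run through `|B|, …, 1`, so this is `∑ 1 / √k ≤ 2 * √|B|`. Inserting
a new minimum leaves the later tails unchanged, which suits induction. -/
theorem sum_inv_sqrt_card_groupFrom_le (B : Finset (Fin T)) :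
    ∑ t ∈ B, (√((groupFrom B t).card : ℝ))⁻¹ ≤ 2 * √(B.card : ℝ) := by
  induction B using Finset.induction_on_min with
  | empty => simp
  | insert a S ha ih =>
    have hna : a ∉ S := fun h => lt_irrefl _ (ha a h)
    have h1 : groupFrom (insert a S) a = insert a S := by
      rw [groupFrom, Finset.filter_true_of_mem]
      intro s hs
      rcases Finset.mem_insert.1 hs with rfl | hs
      · exact le_rfl
      · exact (ha s hs).le
    have h2 : ∀ t ∈ S, groupFrom (insert a S) t = groupFrom S t := fun t ht => by
      rw [groupFrom, Finset.filter_insert, if_neg (not_le.2 (Fin.lt_def.1 (ha t ht))), groupFrom]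
    rw [Finset.sum_insert hna, h1, Finset.sum_congr rfl fun t ht => by rw [h2 t ht],
      Finset.card_insert_of_notMem hna]
    push_cast
    set n : ℝ := (S.card : ℝ)
    have hn : 0 ≤ n := Nat.cast_nonneg _
    have hx : 0 ≤ √n := Real.sqrt_nonneg _
    have hy : 0 < √(n + 1) := Real.sqrt_pos.2 (by linarith)
    have hx2 := Real.sq_sqrt hn
    have hy2 := Real.sq_sqrt (show 0 ≤ n + 1 by linarith)
    have : (√(n + 1))⁻¹ ≤ 2 * √(n + 1) - 2 * √n := by
      rw [inv_le_iff_one_le_mul₀ hy]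
      nlinarith [sq_nonneg (√(n + 1) - √n)]
    linarith

end SamplingWithoutReplacement

/-! ### Transport between a group and all time steps. -/

section Transport

variable {T : ℕ} {E : Type*}

/-- A Lipschitz function has close means over two distributions of small Wasserstein distance. -/
theorem norm_mean_sub_mean_le [NormedAddCommGroup E] [NormedSpace ℝ E] (η : ℕ → ℝ)
    (p : Fin T → E) {K : ℝ} (hK : 0 < K) (hp : ∀ i j, ‖p i - p j‖ ≤ K * timeDist η i j)
    {B : Finset (Fin T)} (hB : B.Nonempty) :
    ‖(B.card : ℝ)⁻¹ • ∑ t ∈ B, p t - (T : ℝ)⁻¹ • ∑ t, p t‖ ≤ K * groupWasserstein η B := by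
  have hBpos : (0 : ℝ) < B.card := by exact_mod_cast hB.card_pos
  have hTpos : (0 : ℝ) < T := by
    obtain ⟨t, -⟩ := hB
    exact_mod_cast t.pos
  rw [← div_le_iff₀' hK, groupWasserstein]
  -- The product coupling shows that the infimum is over a nonempty set.
  refine le_csInf ⟨_, fun _ _ => (T : ℝ)⁻¹ * (B.card : ℝ)⁻¹, fun _ _ => by positivity,
    fun _ => ?_, fun _ => ?_, rfl⟩ ?_
  · simp only [Finset.sum_const, Finset.card_univ, Fintype.card_coe, nsmul_eq_mul]
    field_simp
  · simp only [Finset.sum_const, Finset.card_univ, Fintype.card_fin, nsmul_eq_mul]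
    field_simp
  rintro c ⟨q, hq0, hqT, hqB, rfl⟩
  rw [div_le_iff₀' hK]
  have e1 : (B.card : ℝ)⁻¹ • ∑ t ∈ B, p t = ∑ i : B, ∑ j, q i j • p i := by
    rw [← Finset.sum_coe_sort, Finset.smul_sum]
    refine Finset.sum_congr rfl fun i _ => ?_
    rw [← Finset.sum_smul, hqB, one_div]
  have e2 : (T : ℝ)⁻¹ • ∑ t, p t = ∑ i : B, ∑ j, q i j • p j := by
    rw [Finset.sum_comm, Finset.smul_sum]
    refine Finset.sum_congr rfl fun j _ => ?_
    rw [← Finset.sum_smul, hqT, one_div]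
  rw [e1, e2, ← Finset.sum_sub_distrib, Finset.mul_sum]
  refine (norm_sum_le _ _).trans (Finset.sum_le_sum fun i _ => ?_)
  rw [← Finset.sum_sub_distrib, Finset.mul_sum]
  refine (norm_sum_le _ _).trans (Finset.sum_le_sum fun j _ => ?_)
  rw [← smul_sub, norm_smul, Real.norm_eq_abs, abs_of_nonneg (hq0 i j)]
  nlinarith [hp i j, hq0 i j]

/-- Within a group the sum is `|B|` times the inner product of the two group means. Replacing the
group mean of `p` by its overall mean costs at most `A * K * |B|` times the Wasserstein distance,
and the terms so obtained add up to a single inner product with `∑ a`. -/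
theorem sum_inner_group_mean_le [NormedAddCommGroup E] [InnerProductSpace ℝ E] (η : ℕ → ℝ)
    (P : Finpartition (Finset.univ : Finset (Fin T))) (p a : Fin T → E) {K A : ℝ} (hK : 0 < K)
    (hA : 0 ≤ A) (hp : ∀ i j, ‖p i - p j‖ ≤ K * timeDist η i j) (ha : ∀ t, ‖a t‖ ≤ A) :
    ∑ t, inner ℝ (p t) (((P.part t).card : ℝ)⁻¹ • ∑ s ∈ P.part t, a s) ≤
      inner ℝ ((T : ℝ)⁻¹ • ∑ t, p t) (∑ t, a t) +
        ∑ B ∈ P.parts, A * K * (B.card * groupWasserstein η B) := by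
  rw [sum_part_eq P fun B t => inner ℝ (p t) ((B.card : ℝ)⁻¹ • ∑ s ∈ B, a s),
    ← sum_parts_sum P a, inner_sum, ← Finset.sum_add_distrib]
  refine Finset.sum_le_sum fun B hB => ?_
  have hne := P.nonempty_of_mem_parts hB
  have hBpos : (0 : ℝ) < B.card := by exact_mod_cast hne.card_pos
  set x := (B.card : ℝ)⁻¹ • ∑ t ∈ B, p t with hx
  set y := (B.card : ℝ)⁻¹ • ∑ t ∈ B, a t with hy
  set z := (T : ℝ)⁻¹ • ∑ t, p t with hz
  have hxs : ∑ t ∈ B, p t = (B.card : ℝ) • x := by rw [hx, smul_inv_smul₀ hBpos.ne']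
  have hys : ∑ t ∈ B, a t = (B.card : ℝ) • y := by rw [hy, smul_inv_smul₀ hBpos.ne']
  have e : ∑ t ∈ B, inner ℝ (p t) y = B.card * inner ℝ x y := by
    rw [← sum_inner, hxs, inner_smul_left]
    rfl
  refine (le_of_eq e).trans ?_
  rw [hys, inner_smul_right z y]
  have h1 : inner ℝ (x - z) y ≤ (K * groupWasserstein η B) * A :=
    (real_inner_le_norm _ _).trans (mul_le_mul (norm_mean_sub_mean_le η p hK hp hne)
      (norm_inv_card_smul_sum_le B a hA fun t _ => ha t) (norm_nonneg _)
      ((norm_nonneg _).trans (norm_mean_sub_mean_le η p hK hp hne)))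
  rw [inner_sub_left] at h1
  change _ ≤ (B.card : ℝ) * inner ℝ z y + _
  nlinarith

end Transport

theorem EuclideanSpace.norm_le_sqrt_mul {m : ℕ} (w : Vec m) {D : ℝ} (hD : 0 ≤ D)
    (hw : ∀ i, |w i| ≤ D) : ‖w‖ ≤ √(m : ℝ) * D := by
  rw [EuclideanSpace.norm_eq, ← Real.sqrt_sq hD, ← Real.sqrt_mul (Nat.cast_nonneg _)]
  refine Real.sqrt_le_sqrt ?_
  refine (Finset.sum_le_sum fun i _ => ?_).trans
    (le_of_eq (by simp : ∑ _ : Fin m, D ^ 2 = (m : ℝ) * D ^ 2))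
  exact pow_le_pow_left₀ (norm_nonneg _) (hw i) 2

/-! ### Estimates for the step sizes. -/

section StepSize

theorem stepSize_nonneg (m t : ℕ) : 0 ≤ stepSize m t :=
  le_min (by positivity) (by positivity)

theorem stepSize_pos {m t : ℕ} (hm : 1 ≤ m) (ht : 1 ≤ t) : 0 < stepSize m t := by
  have h1 : (0 : ℝ) < m := by exact_mod_cast hm
  have h2 : (0 : ℝ) < t := by exact_mod_cast ht
  exact lt_min (by positivity) (by positivity)

theorem stepSize_mul_le_one {m : ℕ} (hm : 1 ≤ m) (t : ℕ) : stepSize m t * m ≤ 1 := by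
  have h1 : (0 : ℝ) < m := by exact_mod_cast hm
  exact (le_div_iff₀ h1).1 (min_le_left _ _)

theorem stepSize_mul_sqrt_le_one {m : ℕ} (hm : 1 ≤ m) (t : ℕ) : stepSize m t * √(m : ℝ) ≤ 1 := by
  have h1 : (1 : ℝ) ≤ m := by exact_mod_cast hm
  refine (mul_le_mul_of_nonneg_left ?_ (stepSize_nonneg m t)).trans (stepSize_mul_le_one hm t)
  exact Real.sqrt_le_iff.2 ⟨by linarith, by nlinarith⟩

/-- The indices are shifted because `stepSize m 0 = 0` (division by zero) would break monotonicity.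
-/
theorem stepSize_succ_le {m : ℕ} (hm : 1 ≤ m) {s t : ℕ} (h : s ≤ t) :
    stepSize m (t + 1) ≤ stepSize m (s + 1) := by
  have h1 : (0 : ℝ) < m := by exact_mod_cast hm
  refine min_le_min_left _ (one_div_le_one_div_of_le (by positivity) (Real.sqrt_le_sqrt ?_))
  gcongr

/-- This bounds the last weight of the summation by parts. `m ≤ T` gives `m ≤ √(m * T)`, which
handles the branch `1 / m` of the minimum. -/
theorem inv_stepSize_le {m T : ℕ} (hm : 1 ≤ m) (hT : m ≤ T) :
    (2 * stepSize m (T + 1))⁻¹ ≤ √((m : ℝ) * T) := by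
  have h1 : (1 : ℝ) ≤ m := by exact_mod_cast hm
  have h2 : (m : ℝ) ≤ T := by exact_mod_cast hT
  have hpos : 0 < √((m : ℝ) * T) := Real.sqrt_pos.2 (by nlinarith)
  rw [inv_le_comm₀ (mul_pos two_pos (stepSize_pos hm (by omega))) hpos]
  suffices h : (√((m : ℝ) * T))⁻¹ / 2 ≤ stepSize m (T + 1) by linarith
  have e : (√((m : ℝ) * T))⁻¹ / 2 = 1 / (2 * √((m : ℝ) * T)) := by field_simp
  rw [e]
  refine le_min (one_div_le_one_div_of_le (by linarith) ?_)
    (one_div_le_one_div_of_le (Real.sqrt_pos.2 (by positivity)) ?_)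
  · have : (m : ℝ) ≤ √((m : ℝ) * T) := Real.le_sqrt_of_sq_le (by nlinarith)
    linarith
  · refine Real.sqrt_le_iff.2 ⟨by positivity, ?_⟩
    rw [mul_pow, Real.sq_sqrt (by positivity)]
    push_cast
    nlinarith

theorem sum_stepSize_mul_le {m : ℕ} (hm : 1 ≤ m) (T : ℕ) :
    (∑ t : Fin T, stepSize m ((t : ℕ) + 1)) * m ≤ 2 * √((m : ℝ) * T) := by
  have h1 : (0 : ℝ) < m := by exact_mod_cast hm
  rw [Fin.sum_univ_eq_sum_range fun t => stepSize m (t + 1)]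
  induction T with
  | zero => simp
  | succ n ih =>
    rw [Finset.sum_range_succ, add_mul]
    have h2 : stepSize m (n + 1) * m ≤ 2 * √((m : ℝ) * (n + 1 : ℕ)) - 2 * √((m : ℝ) * n) := by
      have hle : stepSize m (n + 1) ≤ 1 / √((m : ℝ) * (n + 1 : ℕ)) := min_le_right _ _
      refine (mul_le_mul_of_nonneg_right hle h1.le).trans ?_
      have hy : 0 < √((m : ℝ) * (n + 1 : ℕ)) := Real.sqrt_pos.2 (by positivity)
      have hy2 := Real.sq_sqrt (show 0 ≤ (m : ℝ) * (n + 1 : ℕ) by positivity)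
      have hx2 := Real.sq_sqrt (show 0 ≤ (m : ℝ) * n by positivity)
      rw [div_mul_eq_mul_div, one_mul, div_le_iff₀ hy]
      set y := √((m : ℝ) * (n + 1 : ℕ))
      set x := √((m : ℝ) * n)
      push_cast at hy2
      nlinarith [sq_nonneg (y - x)]
    linarith

end StepSize

/-- Summation by parts for the potential `‖p‖ ^ 2` with increasing weights `1 / (2 * η)`: each
increase of the weight multiplies a nonpositive `x t - b`. -/
theorem sum_telescope_mul_ge (T : ℕ) (x : Fin (T + 1) → ℝ) (h : ℕ → ℝ) {b : ℝ}
    (hx : ∀ t, x t ≤ b) (hh : Monotone h) :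
    (x (Fin.last T) - b) * h T ≤ ∑ t : Fin T, (x t.succ - x t.castSucc) * h t + (x 0 - b) * h 0 := by
  induction T with
  | zero => simp
  | succ n ih =>
    rw [Fin.sum_univ_castSucc]
    have h1 := ih (fun t => x t.castSucc) fun t => hx _
    have h2 : h n ≤ h (n + 1) := hh (Nat.le_succ n)
    have h3 := hx (Fin.last (n + 1))
    simp only [Fin.val_castSucc, Fin.val_last, Fin.succ_last, Fin.castSucc_zero,
      Fin.succ_castSucc] at h1 ⊢
    nlinarith

/-! ### Deterministic analysis of the dual multipliers. -/

namespace ODMP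

variable {T m : ℕ}

theorem convex_polarCone (I : ODMP T m) : Convex ℝ I.polarCone := by
  intro x hx y hy a b ha hb _ v hv
  rw [inner_add_left, inner_smul_left, inner_smul_left]
  have h1 := hx v hv
  have h2 := hy v hv
  simp only [conj_trivial]
  nlinarith

theorem zero_mem_polarCone (I : ODMP T m) : 0 ∈ I.polarCone := fun v _ => by simp

/-- The angle at the projection is obtuse: `⟪z - q, s - q⟫ ≤ 0`. -/
theorem IsProjection.norm_sub_sq_le {S : Set (Vec m)} (hS : Convex ℝ S) {z q : Vec m}
    (h : IsProjection S z q) {s : Vec m} (hs : s ∈ S) :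
    ‖q - s‖ ^ 2 ≤ ‖z - s‖ ^ 2 - ‖z - q‖ ^ 2 := by
  have h1 : ‖z - q‖ = ⨅ w : S, ‖z - w‖ := by
    have : Nonempty S := ⟨⟨q, h.1⟩⟩
    refine le_antisymm (le_ciInf fun w => ?_) (ciInf_le ⟨0, ?_⟩ (⟨q, h.1⟩ : S))
    · simpa only [dist_eq_norm] using h.2 w w.2
    · rintro _ ⟨w, rfl⟩
      exact norm_nonneg _
  have h2 := (norm_eq_iInf_iff_real_inner_le_zero hS h.1).1 h1 s hs
  have h3 := norm_add_sq_real (z - q) (q - s)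
  rw [sub_add_sub_cancel] at h3
  have h4 : inner ℝ (z - q) (q - s) = -inner ℝ (z - q) (s - q) := by
    rw [← inner_neg_right, neg_sub]
  linarith

theorem IsProjection.norm_sub_le {S : Set (Vec m)} (hS : Convex ℝ S) {z q : Vec m}
    (h : IsProjection S z q) {s : Vec m} (hs : s ∈ S) : ‖q - s‖ ≤ ‖z - s‖ := by
  refine abs_le_of_sq_le_sq' ?_ (norm_nonneg _) |>.2
  linarith [h.norm_sub_sq_le hS hs, sq_nonneg ‖z - q‖]

theorem IsProjection.unique {S : Set (Vec m)} (hS : Convex ℝ S) {z q q' : Vec m}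
    (h : IsProjection S z q) (h' : IsProjection S z q') : q = q' := by
  have h1 := h.norm_sub_sq_le hS h'.1
  have h2 := h'.2 q h.1
  rw [dist_eq_norm, dist_eq_norm] at h2
  have h3 : ‖q - q'‖ ^ 2 ≤ 0 := by nlinarith [norm_nonneg (z - q'), norm_nonneg (z - q)]
  exact sub_eq_zero.1 (norm_eq_zero.1 (pow_eq_zero_iff two_ne_zero |>.1
    (le_antisymm h3 (sq_nonneg _))))

theorem SlaterAssumption.mono {I : ODMP T m} {dy dy' dr dlow : ℝ}
    (h : I.SlaterAssumption dy dr dlow) (hle : dy ≤ dy') : I.SlaterAssumption dy' dr dlow :=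
  ⟨fun t w hw v hv i => (h.impact_bound t w hw v hv i).trans hle, h.strongly_feasible⟩

theorem SlaterAssumption.permute {I : ODMP T m} {dy dr dlow : ℝ}
    (h : I.SlaterAssumption dy dr dlow) (π : Equiv.Perm (Fin T)) :
    (I.permute π).SlaterAssumption dy dr dlow :=
  ⟨fun t => h.impact_bound (π t), fun t => h.strongly_feasible (π t)⟩

theorem SlaterAssumption.impact_bound_convexHull {I : ODMP T m} {dy dr dlow : ℝ}
    (h : I.SlaterAssumption dy dr dlow) {t : Fin T} {w : LocalPoint (I.dim t) m}
    (hw : w ∈ convexHull ℝ (I.localSet t)) {v : Vec m} (hv : v ∈ I.Q) (i : Fin m) :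
    |w.impact i - v i| ≤ dy := by
  have hconv : Convex ℝ {w : LocalPoint (I.dim t) m | |w.impact i - v i| ≤ dy} := by
    intro x hx y hy a b ha hb hab
    simp only [Set.mem_ofPred_eq, abs_le] at hx hy ⊢
    have e : (a • x + b • y).impact i = a * x.impact i + b * y.impact i := rfl
    have e2 : v i = a * v i + b * v i := by rw [← add_mul, hab, one_mul]
    have e3 : dy = a * dy + b * dy := by rw [← add_mul, hab, one_mul]
    rw [e, e2, e3]
    constructor <;> nlinarith
  exact convexHull_min (fun w hw => h.impact_bound t w hw v hv i) hconv hw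

/-- By linearity, maximizers over a local set also compete with the convexified decisions of the
relaxation. -/
theorem reward_sub_inner_le_of_mem_convexHull {d : ℕ} {S : Set (LocalPoint d m)} (p : Vec m)
    {c : ℝ} (hS : ∀ w ∈ S, w.reward - inner ℝ p w.impact ≤ c) {w : LocalPoint d m}
    (hw : w ∈ convexHull ℝ S) : w.reward - inner ℝ p w.impact ≤ c := by
  have hconv : Convex ℝ {w : LocalPoint d m | w.reward - inner ℝ p w.impact ≤ c} := by
    refine convex_halfSpace_le ⟨fun x y => ?_, fun a x => ?_⟩ c
    · change x.1 + y.1 - inner ℝ p (x.2.2 + y.2.2) =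
        x.1 - inner ℝ p x.2.2 + (y.1 - inner ℝ p y.2.2)
      rw [inner_add_right]
      ring
    · change a * x.1 - inner ℝ p (a • x.2.2) = a * (x.1 - inner ℝ p x.2.2)
      rw [inner_smul_right]
      ring
  exact convexHull_min hS hconv hw

/-- A bound for the norms of the dual multipliers. -/
noncomputable def dualBound (dy dr dlow : ℝ) : ℝ := (2 * dr + dy ^ 2) / (2 * dlow) + dy

namespace IsRun

variable {I : ODMP T m} {η : ℕ → ℝ} {τ : I.Trajectory} {dy dr dlow : ℝ}

theorem p_mem_polarCone (h : I.IsRun η τ) (t : Fin (T + 1)) : τ.p t ∈ I.polarCone := by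
  induction t using Fin.cases with
  | zero => rw [h.init]; exact I.zero_mem_polarCone
  | succ t => exact (h.step t).1

theorem norm_v_sub_impact_le (h : I.IsRun η τ) (hI : I.SlaterAssumption dy dr dlow)
    (hdy : 0 ≤ dy) (t : Fin T) : ‖τ.v t - (τ.dec t).impact‖ ≤ √(m : ℝ) * dy := by
  refine EuclideanSpace.norm_le_sqrt_mul _ hdy fun i => ?_
  rw [PiLp.sub_apply, abs_sub_comm]
  exact hI.impact_bound t _ (h.dec_mem t) _ (h.v_mem t) i

theorem inner_goal_le (h : I.IsRun η τ) (t : Fin T) {g : Vec m} (hg : g ∈ I.goalSet) :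
    inner ℝ (τ.p t.castSucc) g ≤ inner ℝ (τ.p t.castSucc) (τ.v t) := by
  obtain ⟨u, hu, c, hc, rfl⟩ := Set.mem_add.1 hg
  rw [inner_add_right]
  linarith [h.v_max t u hu, h.p_mem_polarCone t.castSucc c hc]

/-- The interior point can be pushed by `dlow` in the direction of `p` without leaving the goal set,
so `⟪p, v⟫` beats its impact by `dlow * ‖p‖`. Optimality of the decision loses at most `dr`. Large
multipliers are thus pulled back. -/
theorem le_inner_p (h : I.IsRun η τ) (hI : I.SlaterAssumption dy dr dlow) (hdlow : 0 < dlow)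
    (t : Fin T) : dlow * ‖τ.p t.castSucc‖ - dr ≤
      inner ℝ (τ.p t.castSucc) (τ.v t - (τ.dec t).impact) := by
  obtain ⟨u, hu, hur, hball⟩ := hI.strongly_feasible t
  set p := τ.p t.castSucc
  have h1 := reward_sub_inner_le_of_mem_convexHull p (h.dec_max t) hu
  have h2 := hur _ (h.dec_mem t)
  -- For `p = 0` the quotient is `0` and the point is the centre of the ball.
  have h3 : inner ℝ p (u.impact + (dlow / ‖p‖) • p) ≤ inner ℝ p (τ.v t) := by
    refine h.inner_goal_le t (hball ?_)
    rw [Metric.mem_closedBall, dist_eq_norm, add_sub_cancel_left, norm_smul, norm_div, norm_norm,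
      Real.norm_of_nonneg hdlow.le]
    rw [div_mul_eq_mul_div]
    exact div_le_of_le_mul₀ (norm_nonneg _) hdlow.le le_rfl
  have h4 : inner ℝ p ((dlow / ‖p‖) • p) = dlow * ‖p‖ := by
    rw [inner_smul_right, real_inner_self_eq_norm_sq]
    rcases eq_or_ne ‖p‖ 0 with hp | hp
    · simp [hp]
    · field_simp
  rw [inner_add_right, h4] at h3
  rw [inner_sub_right]
  linarith

theorem norm_p_succ_sub_le (h : I.IsRun η τ) (hI : I.SlaterAssumption dy dr dlow)
    (hdy : 0 ≤ dy) (hη : ∀ t, 0 ≤ η t) (t : Fin T) :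
    ‖τ.p t.succ - τ.p t.castSucc‖ ≤ √(m : ℝ) * dy * η ((t : ℕ) + 1) := by
  refine ((h.step t).norm_sub_le I.convex_polarCone (h.p_mem_polarCone _)).trans ?_
  rw [sub_sub_cancel_left, norm_neg, norm_smul, Real.norm_of_nonneg (hη _), mul_comm]
  exact mul_le_mul_of_nonneg_right (h.norm_v_sub_impact_le hI hdy t) (hη _)

theorem norm_p_succ_sq_le (h : I.IsRun η τ) (hI : I.SlaterAssumption dy dr dlow)
    (hdy : 0 ≤ dy) (t : Fin T) :
    ‖τ.p t.succ‖ ^ 2 ≤ ‖τ.p t.castSucc‖ ^ 2 -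
      2 * η ((t : ℕ) + 1) * inner ℝ (τ.p t.castSucc) (τ.v t - (τ.dec t).impact) +
      η ((t : ℕ) + 1) ^ 2 * (m * dy ^ 2) := by
  set e := η ((t : ℕ) + 1)
  set g := τ.v t - (τ.dec t).impact
  have h1 := (h.step t).norm_sub_le I.convex_polarCone I.zero_mem_polarCone
  rw [sub_zero, sub_zero] at h1
  have h2 := pow_le_pow_left₀ (norm_nonneg _) h1 2
  rw [norm_sub_sq_real, inner_smul_right, norm_smul, mul_pow, Real.norm_eq_abs, sq_abs] at h2
  have h3 : ‖g‖ ^ 2 ≤ m * dy ^ 2 := by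
    have := pow_le_pow_left₀ (norm_nonneg _) (h.norm_v_sub_impact_le hI hdy t) 2
    rwa [mul_pow, Real.sq_sqrt (Nat.cast_nonneg _)] at this
  have h4 := mul_le_mul_of_nonneg_left h3 (sq_nonneg e)
  linarith

/-- Above the threshold `(2 * dr + dy ^ 2) / (2 * dlow)` the inward pull outweighs the quadratic
term, since `η * m ≤ 1`, and the norm does not grow. Below it, one step adds at most `η * √m * dy ≤
dy`. -/
theorem norm_p_le (hm : 1 ≤ m) (h : I.IsRun (stepSize m) τ) (hI : I.SlaterAssumption dy dr dlow)
    (hdy : 0 ≤ dy) (hdr : 0 ≤ dr) (hdlow : 0 < dlow) (t : Fin (T + 1)) :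
    ‖τ.p t‖ ≤ dualBound dy dr dlow := by
  induction t using Fin.induction with
  | zero =>
    rw [h.init, norm_zero, dualBound]
    positivity
  | succ t ih =>
    set e := stepSize m ((t : ℕ) + 1) with he
    have he0 : 0 ≤ e := stepSize_nonneg _ _
    have hem : e * m ≤ 1 := stepSize_mul_le_one hm _
    have hes : e * √(m : ℝ) ≤ 1 := stepSize_mul_sqrt_le_one hm _
    rcases le_total (2 * dr + dy ^ 2) (‖τ.p t.castSucc‖ * (2 * dlow)) with hc | hc
    · refine le_trans ?_ ih
      refine abs_le_of_sq_le_sq' ?_ (norm_nonneg _) |>.2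
      have h1 := h.norm_p_succ_sq_le hI hdy t
      have h2 := mul_le_mul_of_nonneg_left (h.le_inner_p hI hdlow t) he0
      have h3 : e ^ 2 * (m * dy ^ 2) ≤ e * dy ^ 2 := by
        have := mul_le_mul_of_nonneg_right hem (mul_nonneg he0 (sq_nonneg dy))
        nlinarith
      have h4 := mul_le_mul_of_nonneg_left hc he0
      rw [← he] at h1
      nlinarith
    · have h1 : ‖τ.p t.castSucc‖ ≤ (2 * dr + dy ^ 2) / (2 * dlow) := by
        rwa [le_div_iff₀ (by positivity)]
      have h2 := h.norm_p_succ_sub_le hI hdy (stepSize_nonneg m) t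
      have h3 : √(m : ℝ) * dy * e ≤ dy := by nlinarith
      have h4 := norm_sub_norm_le (τ.p t.succ) (τ.p t.castSucc)
      rw [dualBound]
      linarith

theorem norm_p_sub_p_le (h : I.IsRun η τ) (hI : I.SlaterAssumption dy dr dlow)
    (hdy : 0 ≤ dy) (hη : ∀ t, 0 ≤ η t) (i j : Fin T) :
    ‖τ.p i.castSucc - τ.p j.castSucc‖ ≤ √(m : ℝ) * dy * timeDist η i j := by
  have key : ∀ i j : Fin T, i ≤ j → ‖τ.p i.castSucc - τ.p j.castSucc‖ ≤
      √(m : ℝ) * dy * ∑ t ∈ Finset.Ico i j, η ((t : ℕ) + 1) := by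
    intro i j hij
    -- The extension by zero to all of `ℕ` is never evaluated beyond `T`.
    let q : ℕ → Vec m := fun n => if hn : n < T + 1 then τ.p ⟨n, hn⟩ else 0
    have hq : ∀ t : Fin (T + 1), q t = τ.p t := fun t => dif_pos t.2
    have hd := dist_le_Ico_sum_of_dist_le (f := q) (Fin.le_def.1 hij)
      (d := fun n => √(m : ℝ) * dy * η (n + 1)) fun {k} _ hk => by
        have hkT : k < T := hk.trans j.2
        have := h.norm_p_succ_sub_le hI hdy hη ⟨k, hkT⟩
        rw [dist_comm, dist_eq_norm]
        rw [← hq, ← hq] at this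
        exact this
    have e1 := hq i.castSucc
    have e2 := hq j.castSucc
    rw [Fin.val_castSucc] at e1 e2
    rw [e1, e2, ← Fin.map_valEmbedding_Ico, Finset.sum_map, dist_eq_norm] at hd
    rw [Finset.mul_sum]
    exact hd
  rw [timeDist]
  split_ifs with hij
  · exact key i j hij.le
  · rw [norm_sub_rev]
    exact key j i (not_lt.1 hij)

/-- The recursion for `‖p‖ ^ 2`, divided by `2 * η`, is summed by parts. The final weight and the
sum of the step sizes are both of order `√(m * T)` after multiplication by `b ^ 2` and `m * dy ^ 2`
respectively. -/
theorem sum_inner_p_le (hm : 1 ≤ m) (hT : m ≤ T) (h : I.IsRun (stepSize m) τ)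
    (hI : I.SlaterAssumption dy dr dlow) (hdy : 0 ≤ dy) (hdr : 0 ≤ dr) (hdlow : 0 < dlow) :
    ∑ t, inner ℝ (τ.p t.castSucc) (τ.v t - (τ.dec t).impact) ≤
      (dualBound dy dr dlow ^ 2 + dy ^ 2) * √((m : ℝ) * T) := by
  set b := dualBound dy dr dlow
  set H : ℕ → ℝ := fun n => (2 * stepSize m (n + 1))⁻¹ with hH
  have hpos : ∀ n, 0 < stepSize m (n + 1) := fun n => stepSize_pos hm (by omega)
  have hmono : Monotone H := fun i j hij => by
    simp only [hH]
    exact inv_anti₀ (by linarith [hpos j]) (by linarith [stepSize_succ_le hm hij])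
  have hx : ∀ t, ‖τ.p t‖ ^ 2 ≤ b ^ 2 := fun t =>
    pow_le_pow_left₀ (norm_nonneg _) (h.norm_p_le hm hI hdy hdr hdlow t) 2
  have h1 := sum_telescope_mul_ge T (fun t => ‖τ.p t‖ ^ 2) H hx hmono
  have hstep : ∀ t : Fin T, inner ℝ (τ.p t.castSucc) (τ.v t - (τ.dec t).impact) ≤
      -((‖τ.p t.succ‖ ^ 2 - ‖τ.p t.castSucc‖ ^ 2) * H t) +
        stepSize m ((t : ℕ) + 1) * (m * dy ^ 2 / 2) := fun t => by
    have h2 := h.norm_p_succ_sq_le hI hdy t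
    set e := stepSize m ((t : ℕ) + 1)
    have he : 0 < e := hpos t
    have hHe : H t * (2 * e) = 1 := inv_mul_cancel₀ (by positivity)
    have hH0 : 0 < H t := inv_pos.2 (by positivity)
    have h3 := mul_le_mul_of_nonneg_left h2 hH0.le
    have e1 : H t * (‖τ.p t.castSucc‖ ^ 2 -
        2 * e * inner ℝ (τ.p t.castSucc) (τ.v t - (τ.dec t).impact) + e ^ 2 * (m * dy ^ 2)) =
        H t * ‖τ.p t.castSucc‖ ^ 2 - (H t * (2 * e)) *
          inner ℝ (τ.p t.castSucc) (τ.v t - (τ.dec t).impact) +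
          (H t * (2 * e)) * (e * (m * dy ^ 2 / 2)) := by ring
    rw [e1, hHe] at h3
    linarith
  have h4 := Finset.sum_le_sum fun t (_ : t ∈ Finset.univ) => hstep t
  rw [Finset.sum_add_distrib, Finset.sum_neg_distrib, ← Finset.sum_mul] at h4
  have h5 := sum_stepSize_mul_le hm T
  have h6 : (∑ t : Fin T, stepSize m ((t : ℕ) + 1)) * (m * dy ^ 2 / 2) ≤
      dy ^ 2 * √((m : ℝ) * T) := by
    have := mul_le_mul_of_nonneg_right h5 (show 0 ≤ dy ^ 2 / 2 by positivity)
    linarith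
  have h7 : b ^ 2 * H T ≤ b ^ 2 * √((m : ℝ) * T) :=
    mul_le_mul_of_nonneg_left (inv_stepSize_le hm hT) (sq_nonneg b)
  have h8 : 0 ≤ ‖τ.p (Fin.last T)‖ ^ 2 * H T :=
    mul_nonneg (sq_nonneg _) (inv_pos.2 (mul_pos two_pos (hpos T))).le
  have h9 : (‖τ.p 0‖ ^ 2 - b ^ 2) * H 0 ≤ 0 :=
    mul_nonpos_of_nonpos_of_nonneg (by linarith [hx 0])
      (inv_pos.2 (mul_pos two_pos (hpos 0))).le
  linarith

/-- Comparison of the accumulated reward with that of arbitrary convexified decisions. -/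
theorem le_totalReward (hm : 1 ≤ m) (hT : m ≤ T) (h : I.IsRun (stepSize m) τ)
    (hI : I.SlaterAssumption dy dr dlow) (hdy : 0 ≤ dy) (hdr : 0 ≤ dr) (hdlow : 0 < dlow)
    (w : (t : Fin T) → LocalPoint (I.dim t) m) (hw : ∀ t, w t ∈ convexHull ℝ (I.localSet t))
    {u : Vec m} (hu : u ∈ I.Q) :
    ∑ t, (w t).reward - ∑ t, inner ℝ (τ.p t.castSucc) ((w t).impact - u) -
      (dualBound dy dr dlow ^ 2 + dy ^ 2) * √((m : ℝ) * T) ≤ τ.totalReward := by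
  refine (sub_le_sub_left (h.sum_inner_p_le hm hT hI hdy hdr hdlow) _).trans ?_
  rw [Trajectory.totalReward, ← Finset.sum_sub_distrib, ← Finset.sum_sub_distrib]
  refine Finset.sum_le_sum fun t _ => ?_
  have h1 := reward_sub_inner_le_of_mem_convexHull _ (h.dec_max t) (hw t)
  have h2 := h.v_max t u hu
  rw [inner_sub_right, inner_sub_right]
  linarith

end IsRun

end ODMP

/-- Predictability of the multipliers: projections onto a convex set are unique, so equal past
choices give equal multipliers. -/
theorem NonAnticipating.p_congr {T m : ℕ} {I : ODMP T m}
    {P : Finpartition (Finset.univ : Finset (Fin T))}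
    {τ : (π : Equiv.Perm (Fin T)) → (I.permute π).Trajectory} (h : NonAnticipating I P τ)
    {η : ℕ → ℝ} (hrun : ∀ π ∈ groupedPerms P, (I.permute π).IsRun η (τ π))
    {π π' : Equiv.Perm (Fin T)} (hπ : π ∈ groupedPerms P) (hπ' : π' ∈ groupedPerms P)
    (n : Fin (T + 1)) (hn : ∀ s : Fin T, s.castSucc < n → π s = π' s) :
    (τ π).p n = (τ π').p n := by
  induction n using Fin.induction with
  | zero => rw [(hrun π hπ).init, (hrun π' hπ').init]
  | succ t ih =>
    have h1 := ih fun s hs => hn s (hs.trans (Fin.castSucc_lt_succ (i := t)))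
    obtain ⟨h2, h3⟩ := h π hπ π' hπ' t fun s hs =>
      hn s (lt_of_le_of_lt (Fin.castSucc_le_castSucc_iff.2 hs) (Fin.castSucc_lt_succ (i := t)))
    have h4 : ((τ π).dec t).impact = ((τ π').dec t).impact :=
      congrArg (fun x : Σ d, LocalPoint d m => x.2.impact) h2
    have h5 := (hrun π hπ).step t
    rw [h1, h3, h4] at h5
    exact h5.unique (I.permute π).convex_polarCone ((hrun π' hπ').step t)

/-! ### Probability bookkeeping and the union bound. -/

theorem timeDist_nonneg {T : ℕ} {η : ℕ → ℝ} (hη : ∀ t, 0 ≤ η t) (i j : Fin T) :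
    0 ≤ timeDist η i j := by
  rw [timeDist]
  split_ifs <;> exact Finset.sum_nonneg fun _ _ => hη _

theorem unevenness_nonneg {T : ℕ} (m : ℕ) {η : ℕ → ℝ} (hη : ∀ t, 0 ≤ η t)
    (P : Finpartition (Finset.univ : Finset (Fin T))) : 0 ≤ unevenness m η P := by
  refine Finset.sum_nonneg fun B _ => mul_nonneg (by positivity) (Real.sInf_nonneg ?_)
  rintro c ⟨q, hq, -, -, rfl⟩
  exact Finset.sum_nonneg fun i _ => Finset.sum_nonneg fun j _ =>
    mul_nonneg (timeDist_nonneg hη _ _) (hq i j)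

/-- Lets errors of order `√(m * T)` be absorbed into the group sum. -/
theorem le_sq_sum_sqrt_card {T : ℕ} (P : Finpartition (Finset.univ : Finset (Fin T))) :
    (T : ℝ) ≤ (∑ B ∈ P.parts, √(B.card : ℝ)) ^ 2 := by
  have h : (T : ℝ) = ∑ B ∈ P.parts, (B.card : ℝ) := by
    have := P.sum_card_parts
    rw [Finset.card_univ, Fintype.card_fin] at this
    exact_mod_cast this.symm
  rw [h, sq, Finset.sum_mul]
  refine Finset.sum_le_sum fun B hB => ?_
  conv_lhs => rw [← Real.mul_self_sqrt (Nat.cast_nonneg B.card)]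
  refine mul_le_mul_of_nonneg_left ?_ (Real.sqrt_nonneg _)
  exact Finset.single_le_sum (f := fun B : Finset (Fin T) => √(B.card : ℝ))
    (fun _ _ => Real.sqrt_nonneg _) hB

theorem avgFrom_apply {T m : ℕ} (B : Finset (Fin T)) (n : ℕ) (a : Fin T → Vec m)
    (π : Equiv.Perm (Fin T)) (i : Fin m) :
    (avgFrom B n a π) i = avgFrom B n (fun s => a s i) π := by
  simp [avgFrom]

theorem avgFrom_neg {T : ℕ} (B : Finset (Fin T)) (n : ℕ) (f : Fin T → ℝ)
    (π : Equiv.Perm (Fin T)) : avgFrom B n (fun s => -f s) π = -avgFrom B n f π := by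
  simp [avgFrom]

open Classical in
theorem ofReal_one_sub_le_groupedLaw {T : ℕ} {P : Finpartition (Finset.univ : Finset (Fin T))}
    {E : Equiv.Perm (Fin T) → Prop} {ρ : ℝ}
    (h : (((groupedPerms P).filter fun π => ¬ E π).card : ℝ) ≤ ρ * (groupedPerms P).card) :
    ENNReal.ofReal (1 - ρ) ≤ (groupedLaw P).toOuterMeasure {π | E π} := by
  have hpos : 0 < (groupedPerms P).card := (groupedPerms_nonempty P).card_pos
  rw [groupedLaw, PMF.toOuterMeasure_uniformOfFinset_apply,
    ENNReal.le_div_iff_mul_le (Or.inl (by exact_mod_cast hpos.ne'))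
      (Or.inl (ENNReal.natCast_ne_top _)),
    ← ENNReal.ofReal_natCast, ← ENNReal.ofReal_natCast,
    ← ENNReal.ofReal_mul' (Nat.cast_nonneg _)]
  refine ENNReal.ofReal_le_ofReal ?_
  have h1 := Finset.card_filter_add_card_filter_not (s := groupedPerms P) E
  have h2 : (((groupedPerms P).filter fun π => E π).card : ℝ) +
      ((groupedPerms P).filter fun π => ¬ E π).card = (groupedPerms P).card := by
    exact_mod_cast h1
  simp only [Set.mem_ofPred_eq]
  linarith

theorem ofReal_one_sub_le_groupedLaw_of_forall {T : ℕ}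
    {P : Finpartition (Finset.univ : Finset (Fin T))} {E : Equiv.Perm (Fin T) → Prop} {ρ : ℝ}
    (hρ : 0 ≤ ρ) (h : ∀ π ∈ groupedPerms P, E π) :
    ENNReal.ofReal (1 - ρ) ≤ (groupedLaw P).toOuterMeasure {π | E π} := by
  classical
  refine ofReal_one_sub_le_groupedLaw ?_
  rw [Finset.filter_false_of_mem fun π hπ => not_not.2 (h π hπ), Finset.card_empty, Nat.cast_zero]
  positivity

open Classical in
/-- The concentration events occur simultaneously with high probability. -/
theorem card_deviation_le {T m : ℕ} (hm : 1 ≤ m) (hT : 1 ≤ T)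
    {P : Finpartition (Finset.univ : Finset (Fin T))}
    (p : Fin T → Equiv.Perm (Fin T) → Vec m) (a : Fin T → Vec m) {b D ρ : ℝ}
    (hp : ∀ t, ∀ π ∈ groupedPerms P, ∀ π' ∈ groupedPerms P, (∀ s < t, π s = π' s) →
      p t π = p t π')
    (hb : ∀ t, ∀ π ∈ groupedPerms P, ‖p t π‖ ≤ b) (ha : ∀ s i, |a s i| ≤ D)
    (hD : 0 < D) (hb0 : 0 < b) (hρ : 0 < ρ) (hρ1 : ρ ≤ 1) {L : ℝ}
    (hL : L = Real.log (3 * m * T / ρ)) :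
    (((groupedPerms P).filter fun π => ¬
        (∑ t, inner ℝ (p t π) (a (π t) - avgFrom (P.part t) t a π) ≤
            √(2 * (T * (b * (2 * (√(m : ℝ) * D))) ^ 2) * L) ∧
          ∀ t i, |(avgFrom (P.part t) t a π - avgFrom (P.part t) 0 a π) i| ≤
            √(2 * (8 * D ^ 2 * ((groupFrom (P.part t) t).card : ℝ)⁻¹) * L))).card : ℝ) ≤
      ρ * (groupedPerms P).card := by
  have hm' : (1 : ℝ) ≤ m := by exact_mod_cast hm
  have hT' : (1 : ℝ) ≤ T := by exact_mod_cast hT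
  have hmT : (1 : ℝ) ≤ m * T := by nlinarith
  have hL0 : 0 ≤ L := by
    rw [hL]
    refine Real.log_nonneg ?_
    rw [le_div_iff₀ hρ]
    nlinarith
  -- There are `1 + 2 * m * T ≤ 3 * m * T` bad events: one martingale, and two signs for each time
  -- and coordinate.
  have hexp : Real.exp (-L) = ρ / (3 * m * T) := by
    rw [hL, Real.exp_neg, Real.exp_log (by positivity), inv_div]
  set G := groupedPerms P with hG
  set S1 := G.filter fun π => √(2 * (T * (b * (2 * (√(m : ℝ) * D))) ^ 2) * L) <
    ∑ t, inner ℝ (p t π) (a (π t) - avgFrom (P.part t) t a π) with hS1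
  set S2 : (Fin m → Fin T → ℝ) → Fin T → Fin m → Finset (Equiv.Perm (Fin T)) :=
    fun f t i => G.filter fun π =>
      √(2 * (8 * D ^ 2 * ((groupFrom (P.part t) t).card : ℝ)⁻¹) * L) <
        avgFrom (P.part t) t (f i) π - avgFrom (P.part t) 0 (f i) π with hS2
  set U : (Fin m → Fin T → ℝ) → Finset (Equiv.Perm (Fin T)) :=
    fun f => (Finset.univ : Finset (Fin T × Fin m)).biUnion fun x => S2 f x.1 x.2 with hU
  have h1 : (S1.card : ℝ) ≤ G.card * Real.exp (-L) :=
    card_inner_tail_le hT p a hp hb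
      (fun s => EuclideanSpace.norm_le_sqrt_mul _ hD.le (ha s)) (by positivity) hb0 hL0
  have h2 : ∀ f : Fin m → Fin T → ℝ, (∀ i s, |f i s| ≤ D) →
      ((U f).card : ℝ) ≤ T * m * (G.card * Real.exp (-L)) := fun f hf => by
    have h3 : ((U f).card : ℝ) ≤ ∑ x : Fin T × Fin m, ((S2 f x.1 x.2).card : ℝ) := by
      exact_mod_cast Finset.card_biUnion_le
    refine h3.trans ((Finset.sum_le_sum fun x _ =>
      card_avgFrom_tail_le (f x.2) (hf x.2) hD hL0 x.1).trans (le_of_eq ?_))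
    rw [Finset.sum_const, Finset.card_univ, Fintype.card_prod, Fintype.card_fin, Fintype.card_fin,
      nsmul_eq_mul]
    push_cast
    rfl
  have hsub : (G.filter fun π => ¬
        (∑ t, inner ℝ (p t π) (a (π t) - avgFrom (P.part t) t a π) ≤
            √(2 * (T * (b * (2 * (√(m : ℝ) * D))) ^ 2) * L) ∧
          ∀ t i, |(avgFrom (P.part t) t a π - avgFrom (P.part t) 0 a π) i| ≤
            √(2 * (8 * D ^ 2 * ((groupFrom (P.part t) t).card : ℝ)⁻¹) * L))) ⊆
      S1 ∪ (U (fun i s => a s i) ∪ U (fun i s => -a s i)) := by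
    intro π hπ
    obtain ⟨hπG, hπ⟩ := Finset.mem_filter.1 hπ
    rw [Finset.mem_union, Finset.mem_union]
    by_contra! hcon
    obtain ⟨c1, c2, c3⟩ := hcon
    refine hπ ⟨?_, fun t i => ?_⟩
    · by_contra! hlt
      exact c1 (Finset.mem_filter.2 ⟨hπG, hlt⟩)
    · rw [PiLp.sub_apply, avgFrom_apply, avgFrom_apply, abs_le']
      constructor
      · by_contra! hlt
        exact c2 (Finset.mem_biUnion.2 ⟨(t, i), Finset.mem_univ _,
          Finset.mem_filter.2 ⟨hπG, hlt⟩⟩)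
      · by_contra! hlt
        refine c3 (Finset.mem_biUnion.2 ⟨(t, i), Finset.mem_univ _,
          Finset.mem_filter.2 ⟨hπG, ?_⟩⟩)
        rw [avgFrom_neg, avgFrom_neg]
        linarith
  have h4 := (Finset.card_le_card hsub).trans ((Finset.card_union_le _ _).trans
    (Nat.add_le_add_left (Finset.card_union_le _ _) _))
  have h5 := h2 (fun i s => a s i) fun i s => ha s i
  have h6 := h2 (fun i s => -a s i) fun i s => by rw [abs_neg]; exact ha s i
  refine (Nat.cast_le.2 h4 : (_ : ℝ) ≤ _).trans ?_
  push_cast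
  have h7 : (1 + 2 * (T * m)) * (G.card * Real.exp (-L)) ≤
      (3 * m * T) * (G.card * Real.exp (-L)) :=
    mul_le_mul_of_nonneg_right (by nlinarith) (by positivity)
  have h8 : (3 * m * T) * (G.card * Real.exp (-L)) = ρ * G.card := by
    rw [hexp]
    field_simp
  linarith

/-! ### Assembly of the reward bound. -/

namespace ODMP

/-- The reward bound that holds on the concentration events. -/
theorem IsRun.le_totalReward_of_deviation {T m : ℕ} (hm : 1 ≤ m) (hT : m ≤ T) {Z : ODMP T m}
    {dy dr dlow : ℝ} (hZ : Z.SlaterAssumption dy dr dlow) (hdy : 0 < dy) (hdr : 0 ≤ dr)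
    (hdlow : 0 < dlow) {P : Finpartition (Finset.univ : Finset (Fin T))}
    {π : Equiv.Perm (Fin T)} (hπ : π ∈ groupedPerms P) {τ : (Z.permute π).Trajectory}
    (h : (Z.permute π).IsRun (stepSize m) τ)
    (w : (t : Fin T) → LocalPoint (Z.dim t) m) (hw : ∀ t, w t ∈ convexHull ℝ (Z.localSet t))
    {u c : Vec m} (hu : u ∈ Z.Q) (hc : c ∈ Z.C)
    (hsum : ∑ t, (w t).impact = (T : ℝ) • (u + c)) {a : Fin T → Vec m}
    (ha : ∀ t, a t = (w t).impact - u) {ε L : ℝ} (hL : 0 ≤ L)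
    (h1 : ∑ t, inner ℝ (τ.p t.castSucc) (a (π t) - avgFrom (P.part t) t a π) ≤ ε)
    (h2 : ∀ t i, |(avgFrom (P.part t) t a π - avgFrom (P.part t) 0 a π) i| ≤
      √(2 * (8 * dy ^ 2 * ((groupFrom (P.part t) t).card : ℝ)⁻¹) * L)) :
    ∑ t, (w t).reward - (ε + dualBound dy dr dlow * √(m : ℝ) * (8 * dy * √L) *
        ∑ B ∈ P.parts, √(B.card : ℝ) + dy ^ 2 * unevenness m (stepSize m) P +
        (dualBound dy dr dlow ^ 2 + dy ^ 2) * √((m : ℝ) * T)) ≤ τ.totalReward := by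
  set b := dualBound dy dr dlow
  have hZπ := hZ.permute π
  have hmpos : (0 : ℝ) < m := by exact_mod_cast hm
  have hTpos : (0 : ℝ) < T := by exact_mod_cast hm.trans hT
  have hpb : ∀ t, ‖τ.p t‖ ≤ b := h.norm_p_le hm hZπ hdy.le hdr hdlow
  have hb0 : 0 ≤ b := (norm_nonneg _).trans (hpb 0)
  have haA : ∀ t, ‖a t‖ ≤ √(m : ℝ) * dy := fun t => by
    refine EuclideanSpace.norm_le_sqrt_mul _ hdy.le fun i => ?_
    rw [ha, PiLp.sub_apply]
    exact hZ.impact_bound_convexHull (hw t) hu i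
  have hmain := h.le_totalReward hm hT hZπ hdy.le hdr hdlow (fun t => w (π t))
    (fun t => hw (π t)) hu
  have hr : ∑ t, (w (π t)).reward = ∑ t, (w t).reward :=
    Equiv.sum_comp π fun t => (w t).reward
  -- Martingale difference, drift of the conditional mean, and group mean.
  have hdecomp : ∀ t : Fin T, inner ℝ (τ.p t.castSucc) ((w (π t)).impact - u) =
      inner ℝ (τ.p t.castSucc) (a (π t) - avgFrom (P.part t) t a π) +
      inner ℝ (τ.p t.castSucc) (avgFrom (P.part t) t a π - avgFrom (P.part t) 0 a π) +
      inner ℝ (τ.p t.castSucc) (((P.part t).card : ℝ)⁻¹ • ∑ s ∈ P.part t, a s) := fun t => by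
    rw [← avgFrom_zero (part_mem_parts t) hπ, ← inner_add_right, ← inner_add_right, ha (π t)]
    congr 1
    abel
  have hdrift : ∑ t : Fin T, inner ℝ (τ.p t.castSucc)
      (avgFrom (P.part t) t a π - avgFrom (P.part t) 0 a π) ≤
      b * √(m : ℝ) * (8 * dy * √L) * ∑ B ∈ P.parts, √(B.card : ℝ) := by
    have hstep : ∀ t : Fin T, inner ℝ (τ.p t.castSucc)
        (avgFrom (P.part t) t a π - avgFrom (P.part t) 0 a π) ≤
        b * √(m : ℝ) * (4 * dy * √L) * (√((groupFrom (P.part t) t).card : ℝ))⁻¹ := fun t => by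
      have e : √(2 * (8 * dy ^ 2 * ((groupFrom (P.part t) t).card : ℝ)⁻¹) * L) =
          4 * dy * √L * (√((groupFrom (P.part t) t).card : ℝ))⁻¹ := by
        rw [← Real.sqrt_inv, mul_assoc (4 * dy), ← Real.sqrt_mul hL,
          ← Real.sqrt_sq (show 0 ≤ 4 * dy by positivity), ← Real.sqrt_mul (sq_nonneg _)]
        congr 1
        ring
      have h3 := EuclideanSpace.norm_le_sqrt_mul _ (Real.sqrt_nonneg _) (h2 t)
      refine (real_inner_le_norm _ _).trans ((mul_le_mul (hpb _) h3 (norm_nonneg _) hb0).trans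
        (le_of_eq ?_))
      rw [e]
      ring
    refine (Finset.sum_le_sum fun t _ => hstep t).trans ?_
    rw [← Finset.mul_sum,
      sum_part_eq P fun B t => (√((groupFrom B t).card : ℝ))⁻¹]
    have h4 := Finset.sum_le_sum fun B (_ : B ∈ P.parts) => sum_inv_sqrt_card_groupFrom_le B
    rw [← Finset.mul_sum] at h4
    have h5 := mul_le_mul_of_nonneg_left h4
      (show 0 ≤ b * √(m : ℝ) * (4 * dy * √L) by positivity)
    linarith
  have hmean := sum_inner_group_mean_le (stepSize m) P (fun t => τ.p t.castSucc) a
    (K := √(m : ℝ) * dy) (by positivity) (by positivity)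
    (h.norm_p_sub_p_le hZπ hdy.le (stepSize_nonneg m)) haA
  have hsa : ∑ t, a t = (T : ℝ) • c := by
    simp only [ha]
    rw [Finset.sum_sub_distrib, hsum, Finset.sum_const, Finset.card_univ, Fintype.card_fin,
      ← Nat.cast_smul_eq_nsmul ℝ, smul_add, add_sub_cancel_left]
  -- The choice of `u` leaves only the cone part `T • c` in `∑ a`, and the multipliers lie in the
  -- polar cone.
  have hneg : inner ℝ ((T : ℝ)⁻¹ • ∑ t : Fin T, τ.p t.castSucc) (∑ t, a t) ≤ 0 := by
    rw [hsa, inner_smul_left, inner_smul_right, sum_inner]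
    have h6 : ∑ t : Fin T, inner ℝ (τ.p t.castSucc) c ≤ 0 :=
      Finset.sum_nonpos fun t _ => h.p_mem_polarCone t.castSucc c hc
    simp only [conj_trivial]
    rw [inv_mul_cancel_left₀ hTpos.ne']
    exact h6
  have hW : ∑ B ∈ P.parts, √(m : ℝ) * dy * (√(m : ℝ) * dy) *
      (B.card * groupWasserstein (stepSize m) B) = dy ^ 2 * unevenness m (stepSize m) P := by
    rw [unevenness, Finset.mul_sum]
    refine Finset.sum_congr rfl fun B _ => ?_
    have := Real.mul_self_sqrt hmpos.le
    linear_combination (dy ^ 2 * B.card * groupWasserstein (stepSize m) B) * this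
  have htot : ∑ t : Fin T, inner ℝ (τ.p t.castSucc) ((w (π t)).impact - u) ≤
      ε + b * √(m : ℝ) * (8 * dy * √L) * ∑ B ∈ P.parts, √(B.card : ℝ) +
        dy ^ 2 * unevenness m (stepSize m) P := by
    simp only [hdecomp]
    rw [Finset.sum_add_distrib, Finset.sum_add_distrib]
    linarith
  have hmain' : ∑ t, (w (π t)).reward -
      ∑ t : Fin T, inner ℝ (τ.p t.castSucc) ((w (π t)).impact - u) -
      (b ^ 2 + dy ^ 2) * √((m : ℝ) * T) ≤ τ.totalReward := hmain
  linarith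

theorem relaxedValue_set_nonempty {T m : ℕ} {Z : ODMP T m} (hZ : Z.BasicAssumption) :
    {z : ℝ | ∃ w : (t : Fin T) → LocalPoint (Z.dim t) m,
      (∀ t, w t ∈ convexHull ℝ (Z.localSet t)) ∧
        ∑ t, (w t).impact ∈ (T : ℝ) • Z.goalSet ∧ z = ∑ t, (w t).reward}.Nonempty := by
  obtain ⟨w, hw, hs⟩ := hZ.feasible
  exact ⟨_, w, fun t => subset_convexHull ℝ _ (hw t), hs, rfl⟩

/-- With a single time step, the decision maximizes the reward. -/
theorem IsRun.relaxedValue_le_totalReward {m : ℕ} {Z : ODMP 1 m} (hZ : Z.BasicAssumption)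
    {π : Equiv.Perm (Fin 1)} {η : ℕ → ℝ} {τ : (Z.permute π).Trajectory}
    (h : (Z.permute π).IsRun η τ) : Z.relaxedValue ≤ τ.totalReward := by
  refine csSup_le (relaxedValue_set_nonempty hZ) ?_
  rintro z ⟨w, hw, -, rfl⟩
  obtain rfl : π = 1 := Subsingleton.elim _ _
  rw [Trajectory.totalReward]
  refine Finset.sum_le_sum fun t _ => ?_
  obtain rfl : t = 0 := Subsingleton.elim _ _
  have h1 := reward_sub_inner_le_of_mem_convexHull _ (h.dec_max 0) (hw 0)
  rw [Fin.castSucc_zero, h.init, inner_zero_left, inner_zero_left, sub_zero, sub_zero] at h1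
  exact h1

end ODMP

/-- The error terms are dominated by the claimed rate. -/
theorem error_terms_le {m T : ℕ} (hm : 1 ≤ m) (hmT : m ≤ T) (hT : 2 ≤ T) {ρ b D S W L : ℝ}
    (hρ : 0 < ρ) (hρ1 : ρ ≤ 1) (hb : 0 ≤ b) (hD : 0 ≤ D) (hS : 0 ≤ S) (hTS : (T : ℝ) ≤ S ^ 2)
    (hW : 0 ≤ W) (hL : L = Real.log (3 * m * T / ρ)) :
    √(2 * (T * (b * (2 * (√(m : ℝ) * D))) ^ 2) * L) + b * √(m : ℝ) * (8 * D * √L) * S +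
        D ^ 2 * W + (b ^ 2 + D ^ 2) * √((m : ℝ) * T) + 1 ≤
      (3 * D ^ 2 + 22 * b * D + 2 * b ^ 2 + 2) *
        (W + (√(m * Real.log m) + √(m * Real.log (T / ρ))) * S) := by
  have hm' : (1 : ℝ) ≤ m := by exact_mod_cast hm
  have hmT' : (m : ℝ) ≤ T := by exact_mod_cast hmT
  have hT' : (2 : ℝ) ≤ T := by exact_mod_cast hT
  set Λ := Real.log (T / ρ) with hΛ
  have hq : (2 : ℝ) ≤ T / ρ := by
    rw [le_div_iff₀ hρ]
    nlinarith
  have hlog2 : Real.log 2 ≤ Λ := Real.log_le_log (by norm_num) hq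
  have hΛ4 : 1 / 4 ≤ Λ := by linarith [Real.log_two_gt_d9]
  -- With `x = T / ρ`, `m ≤ T ≤ x` and `2 ≤ x` give `3 * m * x ≤ 4 * x ^ 2 ≤ x ^ 4`.
  have hL4 : L ≤ 4 * Λ := by
    have e : 4 * Λ = Real.log ((T / ρ) ^ 4) := by rw [Real.log_pow, ← hΛ]; norm_num
    rw [hL, e]
    refine Real.log_le_log (by positivity) ?_
    set x := (T : ℝ) / ρ
    have h1 : (m : ℝ) ≤ x := by
      refine hmT'.trans ?_
      rw [le_div_iff₀ hρ]
      nlinarith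
    have h2 : 3 * m * T / ρ = 3 * m * x := by simp only [x]; ring
    rw [h2]
    calc 3 * m * x ≤ 4 * x * x := by nlinarith
      _ = 4 * (x * x) := by ring
      _ ≤ x ^ 2 * (x * x) := mul_le_mul_of_nonneg_right (by nlinarith) (mul_self_nonneg x)
      _ = x ^ 4 := by ring
  have hsm : 1 ≤ √(m : ℝ) := Real.one_le_sqrt.2 hm'
  have hsΛ : 1 / 2 ≤ √Λ := Real.le_sqrt_of_sq_le (by linarith)
  have hsL : √L ≤ 2 * √Λ := by
    refine Real.sqrt_le_iff.2 ⟨by positivity, ?_⟩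
    rw [mul_pow, Real.sq_sqrt (by linarith)]
    linarith
  have hsT : √(T : ℝ) ≤ S := Real.sqrt_le_iff.2 ⟨hS, hTS⟩
  have hsT1 : 1 ≤ √(T : ℝ) := Real.one_le_sqrt.2 (by linarith)
  -- Every error term except `W` is measured against `X`; `2 ≤ T` keeps `X` at least `1 / 2`.
  set X := √(m : ℝ) * √Λ * S with hX
  have hX0 : 0 ≤ X := by positivity
  have hmTX : √((m : ℝ) * T) ≤ 2 * X := by
    rw [Real.sqrt_mul (by linarith)]
    have h1 : √(m : ℝ) * √(T : ℝ) ≤ √(m : ℝ) * S :=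
      mul_le_mul_of_nonneg_left hsT (by linarith)
    have h2 : √(m : ℝ) * S * (1 / 2) ≤ √(m : ℝ) * S * √Λ :=
      mul_le_mul_of_nonneg_left hsΛ (by positivity)
    rw [hX]
    linarith
  have h1X : 1 ≤ 2 * X := by
    refine le_trans ?_ hmTX
    rw [Real.sqrt_mul (by linarith)]
    nlinarith
  have t1 : √(2 * (T * (b * (2 * (√(m : ℝ) * D))) ^ 2) * L) ≤ 6 * b * D * X := by
    refine Real.sqrt_le_iff.2 ⟨by positivity, ?_⟩
    have e1 : (6 * b * D * X) ^ 2 = 36 * (b * (√(m : ℝ) * D)) ^ 2 * (S ^ 2 * √Λ ^ 2) := by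
      rw [hX]; ring
    rw [e1, Real.sq_sqrt (by linarith)]
    have h3 : (T : ℝ) * L ≤ S ^ 2 * (4 * Λ) := by
      refine (mul_le_mul_of_nonneg_left hL4 (by linarith)).trans
        (mul_le_mul_of_nonneg_right hTS (by linarith))
    have h4 := mul_le_mul_of_nonneg_left h3
      (show 0 ≤ 8 * (b * (√(m : ℝ) * D)) ^ 2 by positivity)
    have h5 : 0 ≤ (b * (√(m : ℝ) * D)) ^ 2 * (S ^ 2 * Λ) := by
      have : 0 ≤ Λ := by linarith
      positivity
    linarith
  have t2 : b * √(m : ℝ) * (8 * D * √L) * S ≤ 16 * b * D * X := by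
    have := mul_le_mul_of_nonneg_left hsL (show 0 ≤ b * √(m : ℝ) * 8 * D * S by positivity)
    rw [hX]
    linarith
  have t3 : (b ^ 2 + D ^ 2) * √((m : ℝ) * T) ≤ (b ^ 2 + D ^ 2) * (2 * X) :=
    mul_le_mul_of_nonneg_left hmTX (by positivity)
  -- The term `√(m * log m)` is nonnegative and only enlarges the bound.
  have hXle : W + X ≤ W + (√(m * Real.log m) + √(m * Λ)) * S := by
    rw [Real.sqrt_mul (by linarith : (0 : ℝ) ≤ m) Λ, hX, add_mul]
    have : 0 ≤ √(m * Real.log m) * S := by positivity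
    linarith
  -- Here `22 = 6 + 16` comes from `t1` and `t2`, `2 * b ^ 2 + 2 * D ^ 2` from `t3`, the last `2`
  -- from `h1X`; one more `D ^ 2` covers `W`.
  have hc : 0 ≤ 3 * D ^ 2 + 22 * b * D + 2 * b ^ 2 + 2 := by positivity
  refine le_trans ?_ (mul_le_mul_of_nonneg_left hXle hc)
  have hcW : D ^ 2 * W ≤ (3 * D ^ 2 + 22 * b * D + 2 * b ^ 2 + 2) * W :=
    mul_le_mul_of_nonneg_right (by nlinarith [mul_nonneg hb hD, sq_nonneg b, sq_nonneg D]) hW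
  have hDX : 0 ≤ D ^ 2 * X := by positivity
  linarith

theorem mainTheorem6 (dy dr dlow : ℝ) (hdy : 0 ≤ dy) (hdr : 0 ≤ dr) (hdlow : 0 < dlow) :
    ∃ c : ℝ, 0 < c ∧
      ∀ (m T : ℕ), 1 ≤ m → m ≤ T →
      ∀ Z : ODMP T m, Z.BasicAssumption → Z.SlaterAssumption dy dr dlow →
      ∀ P : Finpartition (Finset.univ : Finset (Fin T)),
      ∀ τ : (π : Equiv.Perm (Fin T)) → (Z.permute π).Trajectory,
        (∀ π ∈ groupedPerms P, (Z.permute π).IsRun (stepSize m) (τ π)) →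
        NonAnticipating Z P τ →
      ∀ ρ : ℝ, 0 < ρ → ρ ≤ 1 →
        ENNReal.ofReal (1 - ρ) ≤ (groupedLaw P).toOuterMeasure
          {π | Z.relaxedValue - c * (unevenness m (stepSize m) P +
              (√(m * Real.log m) + √(m * Real.log (T / ρ))) *
                ∑ B ∈ P.parts, √(B.card : ℝ)) ≤ (τ π).totalReward} := by
  classical
  -- Enlarging `dy` makes `D` and `b` positive even for `dy = 0`, as the tail bounds require.
  set D := dy + 1 with hD
  have hD0 : 0 < D := by positivity
  set b := ODMP.dualBound D dr dlow with hbdef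
  have hb0 : 0 < b := by
    rw [hbdef, ODMP.dualBound]
    positivity
  refine ⟨3 * D ^ 2 + 22 * b * D + 2 * b ^ 2 + 2, by positivity, ?_⟩
  intro m T hm hmT Z hZ hZS P τ hrun hna ρ hρ hρ1
  replace hZS := hZS.mono (show dy ≤ D by linarith)
  have hW := unevenness_nonneg m (stepSize_nonneg m) P
  have hS : 0 ≤ ∑ B ∈ P.parts, √(B.card : ℝ) :=
    Finset.sum_nonneg fun _ _ => Real.sqrt_nonneg _
  -- For `T = 1` and `ρ = 1` the logarithms vanish, so no additive loss is affordable; but the first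
  -- multiplier is `0` and nothing is lost.
  rcases (hm.trans hmT).eq_or_lt with rfl | hT
  · refine ofReal_one_sub_le_groupedLaw_of_forall hρ.le fun π hπ => ?_
    refine le_trans (sub_le_self _ (mul_nonneg (by positivity) ?_))
      ((hrun π hπ).relaxedValue_le_totalReward hZ)
    exact add_nonneg hW (mul_nonneg (add_nonneg (Real.sqrt_nonneg _) (Real.sqrt_nonneg _)) hS)
  -- A solution within `1` of the supremum suffices, so attainment is not needed; this is the `+ 1`
  -- in `error_terms_le`.
  obtain ⟨z, ⟨w, hw, hsum, rfl⟩, hz⟩ := exists_lt_of_lt_csSup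
    (ODMP.relaxedValue_set_nonempty hZ) (sub_one_lt Z.relaxedValue)
  obtain ⟨g, hg, hgsum⟩ := Set.mem_smul_set.1 hsum
  obtain ⟨u, hu, v, hv, rfl⟩ := Set.mem_add.1 hg
  set a : Fin T → Vec m := fun t => (w t).impact - u with ha
  have habs : ∀ s i, |a s i| ≤ D := fun s i => hZS.impact_bound_convexHull (hw s) hu i
  have hL0 : 0 ≤ Real.log (3 * m * T / ρ) := by
    have hm' : (1 : ℝ) ≤ m := by exact_mod_cast hm
    have hT' : (2 : ℝ) ≤ T := by exact_mod_cast hT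
    refine Real.log_nonneg ?_
    rw [le_div_iff₀ hρ]
    nlinarith
  refine ofReal_one_sub_le_groupedLaw (le_trans (Nat.cast_le.2 (Finset.card_le_card ?_))
    (card_deviation_le hm hT.le (fun t π => (τ π).p t.castSucc) a
      (fun t π hπ π' hπ' h => hna.p_congr hrun hπ hπ' _ fun s hs =>
        h s (Fin.castSucc_lt_castSucc_iff.1 hs))
      (fun t π hπ => (hrun π hπ).norm_p_le hm (hZS.permute π) hD0.le hdr hdlow _)
      habs hD0 hb0 hρ hρ1 rfl))
  intro π hπ
  obtain ⟨hπG, hπ⟩ := Finset.mem_filter.1 hπ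
  refine Finset.mem_filter.2 ⟨hπG, fun hgood => hπ ?_⟩
  have h1 := (hrun π hπG).le_totalReward_of_deviation hm hmT hZS hD0 hdr hdlow hπG w hw hu hv
    hgsum.symm (fun _ => rfl) hL0 hgood.1 hgood.2
  have h2 := error_terms_le hm hmT hT hρ hρ1 hb0.le hD0.le hS (le_sq_sum_sqrt_card P) hW rfl
  linarith
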